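/- Consider one machine and a resource allocator. The machine has a state $X(t)\in\{0,1,2\}$ (free; busy with an internal job; busy with an external job), and the allocator keeps an estimate $\hat X(t)\in\{0,1,2\}$ of it, with $X(0)=\hat X(0)=0$. Let $\alpha,\beta,\gamma,\mu,\lambda>0$. When the machine is free, internal jobs arrive at rate $\alpha$ ($X:0\to1$); internal jobs are completed at rate $\beta$ ($X:1\to 0$) and external jobs at rate $\gamma$ ($X:2\to0$). The allocator samples the machine at rate $\mu$; at a sampling instant $\hat X$ is set to $X$. External job requests arrive as a Poisson process of rate $\lambda$. A request is rejected, without any change of state, if $\hat X\in\{1,2\}$, and is accepted if $\hat X=0$. An accepted request makes $(X,\hat X)$ jump to $(2,2)$ if $X=0$; if $X\ne 0$, the job is lost and $\hat X$ is set to $X$. The events of the different kinds are governed by independent Poisson clocks. Then $Y(t)=(X(t),\hat X(t))$ is a continuous-time Markov chain (CTMC) with state space $S=\{0,1\}\times\{0,1\}\cup\{0,1,2\}\times\{2\}$, whose generator $Q$ is given by these rates and transitions. Let $N_A(t)$ and $N_R(t)$ be the numbers of requests accepted and rejected by time $t$, let $N_{FA}(t)$ be the number of requests accepted by time $t$ while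 $X\neq0$, and let $N_{FR}(t)$ be the number of requests rejected by time $t$ while $X=0$ (the states being those just before the arrival of the request). Define $$\mathrm{FAR}=\mathbb E\Big[\limsup_{T\to\infty}\frac{N_{FA}(T)}{N_A(T)}\Big],\qquad \mathrm{FRR}=\mathbb E\Big[\limsup_{T\to\infty}\frac{N_{FR}(T)}{N_R(T)}\Big].$$ Let $S_A=\{(x,\hat x)\in S:\hat x=0\}$ and $S_{FA}=\{(x,\hat x)\in S:\hat x=0,\ x\ne0\}$ be the sets of states in which requests are accepted and falsely accepted, and let $S_R=\{(x,\hat x)\in S:\hat x\neq0\}$ and $S_{FR}=\{(x,\hat x)\in S:\hat x\ne0,\ x=0\}$ be the sets of states in which they are rejected and falsely rejected. Then there is exactly one probability vector $\pi=(\pi_i)_{i\in S}$ with $\pi Q=0$ (the stationary distribution of the CTMC), the sums $\sum_{i\in S_A}\pi_i$ and $\sum_{i\in S_R}\pi_i$ are positive, and $$\mathrm{FAR}=\frac{\sum_{i\in S_{FA}}\pi_i}{\sum_{i\in S_A}\pi_i},\qquad \mathrm{FRR}=\frac{\sum_{i\in S_{FR}}\pi_i}{\sum_{i\in S_R}\pi_i}.$$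 -/

import Mathlib

open MeasureTheory ProbabilityTheory Filter Topology
open scoped NNReal

noncomputable section

namespace MarkovMachine

/-! ### States and events of a single Markov machine with its resource allocator -/

/-- The state space `S = {0,1} × {0,1} ∪ {0,1,2} × {2}` of the pairs `(X, X̂)`:
`X` is the state of the machine (`0` free, `1` busy with an internal job, `2` busy with an external
job), `X̂` is the estimate of `X` held by the resource allocator. -/
def stateSpace : Finset (Fin 3 × Fin 3) :=
  ({0, 1} ×ˢ {0, 1}) ∪ ({0, 1, 2} ×ˢ {2})

/-- The type of states `(X, X̂) ∈ S`. -/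
abbrev State : Type := {y : Fin 3 × Fin 3 // y ∈ stateSpace}

/-- The state of the machine. -/
def State.machine (y : State) : Fin 3 := y.1.1

/-- The estimate held by the resource allocator. -/
def State.estimate (y : State) : Fin 3 := y.1.2

/-- The initial state `X(0) = X̂(0) = 0`. -/
def initialState : State := ⟨(0, 0), by decide⟩

/-- The five kinds of elementary events. -/
inductive Event : Type
  /-- arrival of an internal job (without effect unless the machine is free) -/
  | internalArrival
  /-- completion of an internal job (without effect unless the machine is processing one) -/
  | internalCompletion
  /-- completion of an external job (without effect unless the machine is processing one) -/
  | externalCompletion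
  /-- the resource allocator samples the machine -/
  | sample
  /-- an external job request arrives at the resource allocator -/
  | request
  deriving DecidableEq

instance : Fintype Event where
  elems := {.internalArrival, .internalCompletion, .externalCompletion, .sample, .request}
  complete c := by cases c <;> decide

/-- The rates of the five kinds of events. -/
def rate (α β γ μ lam : ℝ≥0) : Event → ℝ≥0
  | .internalArrival => α
  | .internalCompletion => β
  | .externalCompletion => γ
  | .sample => μ
  | .request => lam

/-- The effect of an event on a pair `(X, X̂)`. A request is rejected unless the estimate is `0`. An
accepted request is assigned to the machine: if the machine is free, it starts to process the job,
otherwise the job is lost; in either case the estimate becomes the actual state. -/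
def stepPair : Event → Fin 3 × Fin 3 → Fin 3 × Fin 3
  | .internalArrival, (x, e) => if x = 0 then (1, e) else (x, e)
  | .internalCompletion, (x, e) => if x = 1 then (0, e) else (x, e)
  | .externalCompletion, (x, e) => if x = 2 then (0, e) else (x, e)
  | .sample, (x, _) => (x, x)
  | .request, (x, e) => if e = 0 then (if x = 0 then (2, 2) else (x, x)) else (x, e)

theorem stepPair_mem (c : Event) (y : Fin 3 × Fin 3) (hy : y ∈ stateSpace) :
    stepPair c y ∈ stateSpace := by
  revert c y
  decide

/-- The effect of an event on a state. -/
def step (c : Event) (y : State) : State := ⟨stepPair c y.1, stepPair_mem c y.1 y.2⟩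

/-- `S_A`: the states in which the resource allocator accepts requests. -/
def acceptStates : Finset State := {y | y.estimate = 0}

/-- `S_FA`: the states in which it accepts requests although the machine is not free. -/
def falseAcceptStates : Finset State := {y | y.estimate = 0 ∧ y.machine ≠ 0}

/-- `S_R`: the states in which the resource allocator rejects requests. -/
def rejectStates : Finset State := {y | y.estimate ≠ 0}

/-- `S_FR`: the states in which it rejects requests although the machine is free. -/
def falseRejectStates : Finset State := {y | y.estimate ≠ 0 ∧ y.machine = 0}

/-! ### The generator of the chain and its stationary distributions -/

/-- The generator matrix of the continuous-time chain: for `i ≠ j` the entry `Q i j` is the total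
rate of the events that lead from `i` to `j`, and the rows sum to zero. -/
def generator (r : Event → ℝ≥0) : Matrix State State ℝ := fun i j =>
  if i = j then -∑ c : Event, (if step c i = i then 0 else (r c : ℝ))
  else ∑ c : Event, (if step c i = j then (r c : ℝ) else 0)

/-- `π` is a probability vector with `π Q = 0`. -/
structure IsStationary (Q : Matrix State State ℝ) (π : State → ℝ) : Prop where
  nonneg : ∀ i, 0 ≤ π i
  sum_eq_one : ∑ i, π i = 1
  vecMul_eq_zero : Matrix.vecMul π Q = 0

/-! ### Poisson clocks, the process, and the metrics -/

/-- `N c`, for `c : ι`, are independent Poisson processes with rates `r c`, relative to the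
filtration `𝓕`: counting processes that start at `0`, are adapted, have nondecreasing
right-continuous paths, and whose increments over `(s, t]` are Poisson with mean `r c * (t - s)`,
independent of each other and jointly independent of the past `𝓕 s`. -/
structure IsPoissonFamily {Ω ι : Type*} {mΩ : MeasurableSpace Ω} (P : Measure Ω)
    (𝓕 : Filtration ℝ≥0 mΩ) (r : ι → ℝ≥0) (N : ι → ℝ≥0 → Ω → ℕ) : Prop where
  adapted : ∀ c t, Measurable[𝓕 t] (N c t)
  zero : ∀ᵐ ω ∂P, ∀ c, N c 0 ω = 0
  mono : ∀ᵐ ω ∂P, ∀ c, Monotone fun t => N c t ω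
  right_cont : ∀ᵐ ω ∂P, ∀ c t, ∀ᶠ s in 𝓝[>] t, N c s ω = N c t ω
  law : ∀ c s t, s ≤ t → P.map (fun ω => N c t ω - N c s ω) = poissonMeasure (r c * (t - s))
  indep : ∀ s t, s ≤ t → iIndepFun (fun c ω => N c t ω - N c s ω) P
  indep_past : ∀ s t, s ≤ t →
    Indep (MeasurableSpace.comap (fun ω c => N c t ω - N c s ω) MeasurableSpace.pi) (𝓕 s) P

/-- The counting path `n` has a point (a jump) at the time `t > 0`. -/
def TicksAt (n : ℝ≥0 → ℕ) (t : ℝ≥0) : Prop := 0 < t ∧ ∀ s < t, n s < n t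

/-- The path `y` has the left limit `a` at the time `t`. -/
def HasLeftLimit (y : ℝ≥0 → State) (t : ℝ≥0) (a : State) : Prop := ∀ᶠ s in 𝓝[<] t, y s = a

/-- The path `y` starts in `(0, 0)`, is right-continuous with left limits, changes at a point of a
clock `n c` according to the event `c`, and does not change at any other time. -/
structure IsDrivenBy (n : Event → ℝ≥0 → ℕ) (y : ℝ≥0 → State) : Prop where
  initial : y 0 = initialState
  right_cont : ∀ t, ∀ᶠ s in 𝓝[>] t, y s = y t
  jump : ∀ t, 0 < t → ∃ a, HasLeftLimit y t a ∧
    (∀ c, TicksAt (n c) t → y t = step c a) ∧ ((∀ c, ¬ TicksAt (n c) t) → y t = a)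

/-- The process `Y = (X, X̂)` of a Markov machine with event rates `r`, driven by the independent
Poisson processes `N c` of the five kinds of events, with probability one. -/
structure IsMarkovMachine {Ω : Type*} {mΩ : MeasurableSpace Ω} (P : Measure Ω)
    (𝓕 : Filtration ℝ≥0 mΩ) (r : Event → ℝ≥0) (N : Event → ℝ≥0 → Ω → ℕ)
    (Y : ℝ≥0 → Ω → State) : Prop where
  clocks : IsPoissonFamily P 𝓕 r N
  adapted : ∀ t, Measurable[𝓕 t] (Y t)
  driven : ∀ᵐ ω ∂P, IsDrivenBy (fun c t => N c t ω) (fun t => Y t ω)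

/-- The number of external requests in the time interval `(0, T]` that arrive when the state (just
before the arrival) belongs to `A`. -/
def requestCount {Ω : Type*} (N : Event → ℝ≥0 → Ω → ℕ) (Y : ℝ≥0 → Ω → State) (A : Finset State)
    (T : ℝ≥0) (ω : Ω) : ℕ :=
  Set.ncard {t : ℝ≥0 | t ≤ T ∧ TicksAt (fun s => N .request s ω) t ∧
    ∃ a ∈ A, HasLeftLimit (fun s => Y s ω) t a}

/-- The false acceptance ratio `E[limsup_{T → ∞} N_FA(T) / N_A(T)]`. -/
def FAR {Ω : Type*} {mΩ : MeasurableSpace Ω} (P : Measure Ω) (N : Event → ℝ≥0 → Ω → ℕ)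
    (Y : ℝ≥0 → Ω → State) : ℝ :=
  ∫ ω, limsup (fun T : ℝ≥0 =>
    (requestCount N Y falseAcceptStates T ω : ℝ) / (requestCount N Y acceptStates T ω : ℝ)) atTop ∂P

/-- The false rejection ratio `E[limsup_{T → ∞} N_FR(T) / N_R(T)]`. -/
def FRR {Ω : Type*} {mΩ : MeasurableSpace Ω} (P : Measure Ω) (N : Event → ℝ≥0 → Ω → ℕ)
    (Y : ℝ≥0 → Ω → State) : ℝ :=
  ∫ ω, limsup (fun T : ℝ≥0 =>
    (requestCount N Y falseRejectStates T ω : ℝ) / (requestCount N Y rejectStates T ω : ℝ)) atTop ∂P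

end MarkovMachine

end

/-!
The chain is observed along the time grids of mesh `h = 1 / (M + 1)`. Over one step of a grid the
path does nothing if no clock ticks and performs the event of the clock if there is exactly one tick
(`IsDrivenBy.exists_of_single_tick`). Hence both the change of an observable and the number of
requests that find the state in a given set `A` are linear in the tick numbers, with coefficients
that depend on the state at the beginning of the step, up to an error of the order of `excess`, the
number of ticks in the steps with at least two ticks. Its mean per step is `O(h ^ 2)`
(`IsPoissonFamily.integral_excess`).

The tick numbers of a step are independent of the past, so a strong law of large numbers for
orthogonal increments (`ae_tendsto_sum_mul_sub_div`) allows them to be replaced by their means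
`r c * h` in long-run averages. For an indicator of a state, the averaged change telescopes and tends
to zero; this says that the vector `p` of visit frequencies along the grid satisfies `p Q = O(h)` in
the long run. Solving the balance equations shows that a vector is determined by `p Q` and its total
mass, and so `p = π + O(h)` (`exists_abs_sub_le_of_isStationary`). Therefore the number of requests
that find the state in `A` grows at the rate `lam * π(A) + O(h)`. This number does not depend on the
grid, and letting `h` tend to zero gives the exact rate
(`IsDrivenBy.tendsto_ncard_requestTimes_div`). The two ratios converge almost surely to the quotients
of these rates, and expectations of constants remain.
-/

namespace MarkovMachine

/-! ### The stationary distribution -/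

theorem sum_event {M : Type*} [AddCommMonoid M] (f : Event → M) :
    ∑ c, f c = f .internalArrival + f .internalCompletion + f .externalCompletion + f .sample
      + f .request := by
  have h : (Finset.univ : Finset Event) =
      {.internalArrival, .internalCompletion, .externalCompletion, .sample, .request} := rfl
  rw [h]
  simp [add_assoc]

theorem sum_state {M : Type*} [AddCommMonoid M] (f : State → M) :
    ∑ y, f y = f ⟨(0, 0), by decide⟩ + f ⟨(1, 0), by decide⟩ + f ⟨(0, 1), by decide⟩
      + f ⟨(1, 1), by decide⟩ + f ⟨(0, 2), by decide⟩ + f ⟨(1, 2), by decide⟩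
      + f ⟨(2, 2), by decide⟩ := by
  have h : (Finset.univ : Finset State) =
      {⟨(0, 0), by decide⟩, ⟨(1, 0), by decide⟩, ⟨(0, 1), by decide⟩, ⟨(1, 1), by decide⟩,
        ⟨(0, 2), by decide⟩, ⟨(1, 2), by decide⟩, ⟨(2, 2), by decide⟩} := by decide
  rw [h]
  simp [add_assoc]

theorem forall_state {p : State → Prop} :
    (∀ y, p y) ↔ p ⟨(0, 0), by decide⟩ ∧ p ⟨(1, 0), by decide⟩ ∧ p ⟨(0, 1), by decide⟩
      ∧ p ⟨(1, 1), by decide⟩ ∧ p ⟨(0, 2), by decide⟩ ∧ p ⟨(1, 2), by decide⟩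
      ∧ p ⟨(2, 2), by decide⟩ := by
  refine ⟨fun h => ⟨h _, h _, h _, h _, h _, h _, h _⟩, ?_⟩
  rintro ⟨h1, h2, h3, h4, h5, h6, h7⟩ ⟨⟨x, e⟩, hy⟩
  fin_cases x <;> fin_cases e <;> first | assumption | exact absurd hy (by decide)

/-- The diagonal entry of the generator fits the pattern of the others, because an event that leaves
the state unchanged contributes nothing to the right-hand side. -/
theorem generator_apply (r : Event → ℝ≥0) (i j : State) :
    generator r i j =
      ∑ c, ((if step c i = j then 1 else 0) - (if i = j then 1 else 0)) * (r c : ℝ) := by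
  unfold generator
  split_ifs with h
  · subst h
    rw [← Finset.sum_neg_distrib]
    refine Finset.sum_congr rfl fun c _ => ?_
    split_ifs <;> simp
  · refine Finset.sum_congr rfl fun c _ => ?_
    split_ifs <;> simp

/-- The solution of the balance equations `w Q = 0` with `w (0, 0) = 1`. -/
noncomputable def balanceWeight (α β γ μ lam : ℝ) (y : State) : ℝ :=
  if y.1 = (0, 0) then 1
  else if y.1 = (1, 0) then α / (β + μ + lam)
  else if y.1 = (2, 2) then lam / γ
  else if y.1 = (0, 2) then lam * (β + μ) / (μ * (α + β + μ))
  else if y.1 = (1, 2) then α * lam / (μ * (α + β + μ))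
  else if y.1 = (0, 1) then
    (μ + lam) * α / (μ * (β + μ + lam)) + α * lam / (μ * (α + β + μ))
  else (α + μ) / β * ((μ + lam) * α / (μ * (β + μ + lam)) + α * lam / (μ * (α + β + μ)))

section Stationary

variable {α β γ μ lam : ℝ≥0}

theorem balanceWeight_pos (hα : 0 < α) (hβ : 0 < β) (hγ : 0 < γ) (hμ : 0 < μ) (hlam : 0 < lam)
    (y : State) : 0 < balanceWeight α β γ μ lam y := by
  unfold balanceWeight
  split_ifs <;> positivity

/-- The balance equations have, up to a factor, only one solution. -/
theorem vecMul_generator_eq_zero_iff (hα : 0 < α) (hβ : 0 < β) (hγ : 0 < γ) (hμ : 0 < μ)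
    (hlam : 0 < lam) (p : State → ℝ) :
    Matrix.vecMul p (generator (rate α β γ μ lam)) = 0 ↔
      ∀ y, p y = p initialState * balanceWeight α β γ μ lam y := by
  have hα' : (0 : ℝ) < α := hα
  have hβ' : (0 : ℝ) < β := hβ
  have hγ' : (0 : ℝ) < γ := hγ
  have hμ' : (0 : ℝ) < μ := hμ
  have hlam' : (0 : ℝ) < lam := hlam
  rw [funext_iff, forall_state, forall_state]
  simp only [Matrix.vecMul, dotProduct, generator_apply, sum_state, sum_event]
  simp +decide only [rate, balanceWeight, initialState, if_true, if_false,
    Pi.zero_apply]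
  generalize p ⟨(0, 0), _⟩ = a, p ⟨(1, 0), _⟩ = b, p ⟨(0, 1), _⟩ = d, p ⟨(1, 1), _⟩ = c,
    p ⟨(0, 2), _⟩ = f, p ⟨(1, 2), _⟩ = g, p ⟨(2, 2), _⟩ = e
  simp only [sub_self, sub_zero, zero_sub, zero_mul, add_zero, zero_add, mul_zero, one_mul, mul_one]
  constructor
  · rintro ⟨h00, h10, h01, h11, h02, h12, h22⟩
    have hb : b = a * (α / (β + μ + lam)) := by
      field_simp
      linarith
    have he : e = a * (lam / γ) := by
      field_simp
      linarith
    -- eliminating `(1, 2)` from the two equations for the states with estimate `2`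
    have hf : f = a * (lam * (β + μ) / (μ * (α + β + μ))) := by
      field_simp
      linear_combination -(β + μ : ℝ) * h02 - (β : ℝ) * h12 - (β + μ : ℝ) * h22
    -- the balance equation of `(1, 2)`
    have hg : g = a * (α * lam / (μ * (α + β + μ))) := by
      have hg' : g = f * α / (β + μ) := by
        field_simp
        linarith
      rw [hg', hf]
      field_simp
    -- the sum of the two equations for the states with estimate `1`
    have hd : d = a * ((μ + lam) * α / (μ * (β + μ + lam)) + α * lam / (μ * (α + β + μ))) := by
      have hd' : d = (b * (μ + lam) + g * μ) / μ := by
        field_simp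
        linarith
      rw [hd', hb, hg]
      field_simp
    refine ⟨trivial, hb, hd, ?_, hf, hg, he⟩
    have hc' : c = (α + μ) / β * d := by
      field_simp
      linarith
    rw [hc', hd]
    ring
  · rintro ⟨-, rfl, rfl, rfl, rfl, rfl, rfl⟩
    refine ⟨?_, ?_, ?_, ?_, ?_, ?_, ?_⟩ <;> field_simp <;> ring

/-- A vector is determined by `p Q` and its total mass, so in finite dimension it is controlled by
them: a probability vector that nearly solves the balance equations is close to the stationary
distribution. -/
theorem exists_abs_sub_le_of_isStationary (hα : 0 < α) (hβ : 0 < β) (hγ : 0 < γ) (hμ : 0 < μ)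
    (hlam : 0 < lam) {π : State → ℝ}
    (hπ : IsStationary (generator (rate α β γ μ lam)) π) :
    ∃ C : ℝ, 0 ≤ C ∧ ∀ (p : State → ℝ) (ε : ℝ), 0 ≤ ε → ∑ y, p y = 1 →
      (∀ j, |Matrix.vecMul p (generator (rate α β γ μ lam)) j| ≤ ε) →
      ∀ y, |p y - π y| ≤ C * ε := by
  set Q := generator (rate α β γ μ lam) with hQ
  let F : (State → ℝ) →ₗ[ℝ] (State → ℝ) × ℝ :=
    (Matrix.vecMulLinear Q).prod (∑ y, LinearMap.proj y)
  have hF : ∀ v, F v = (Matrix.vecMul v Q, ∑ y, v y) := fun v => by simp [F]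
  have hker : LinearMap.ker F = ⊥ := by
    refine LinearMap.ker_eq_bot'.2 fun v hv => ?_
    rw [hF, Prod.mk_eq_zero] at hv
    obtain ⟨h1, h2⟩ := hv
    rw [hQ, vecMul_generator_eq_zero_iff hα hβ hγ hμ hlam] at h1
    rw [Finset.sum_congr rfl fun y _ => h1 y, ← Finset.mul_sum] at h2
    have hpos : 0 < ∑ y : State, balanceWeight α β γ μ lam y :=
      Finset.sum_pos (fun y _ => balanceWeight_pos hα hβ hγ hμ hlam y) ⟨initialState, by simp⟩
    have h3 : v initialState = 0 := (mul_eq_zero.1 h2).resolve_right hpos.ne'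
    ext y
    rw [h1 y, h3, zero_mul, Pi.zero_apply]
  obtain ⟨K, -, hK⟩ := F.exists_antilipschitzWith hker
  refine ⟨K, K.2, fun p ε hε hp hpQ y => ?_⟩
  have h1 : dist p π ≤ K * dist (F p) (F π) := hK.le_mul_dist p π
  have h2 : dist (F p) (F π) ≤ ε := by
    rw [hF, hF, hp, hπ.sum_eq_one, hπ.vecMul_eq_zero, Prod.dist_eq, dist_self]
    refine max_le ?_ hε
    rw [dist_zero_right, pi_norm_le_iff_of_nonneg hε]
    exact hpQ
  calc |p y - π y| = dist (p y) (π y) := (Real.dist_eq _ _).symm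
    _ ≤ dist p π := dist_le_pi_dist p π y
    _ ≤ K * dist (F p) (F π) := h1
    _ ≤ K * ε := by gcongr

/-- The chain is irreducible, so every state carries stationary mass. -/
theorem IsStationary.pos (hα : 0 < α) (hβ : 0 < β) (hγ : 0 < γ) (hμ : 0 < μ) (hlam : 0 < lam)
    {π : State → ℝ} (hπ : IsStationary (generator (rate α β γ μ lam)) π) (y : State) :
    0 < π y := by
  have h := (vecMul_generator_eq_zero_iff hα hβ hγ hμ hlam π).1 hπ.vecMul_eq_zero
  have h0 : π initialState ≠ 0 := by
    intro h0
    have h1 := hπ.sum_eq_one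
    rw [Finset.sum_congr rfl fun y _ => h y, h0] at h1
    simp at h1
  rw [h y]
  exact mul_pos ((hπ.nonneg _).lt_of_ne' h0) (balanceWeight_pos hα hβ hγ hμ hlam y)

theorem existsUnique_isStationary (hα : 0 < α) (hβ : 0 < β) (hγ : 0 < γ) (hμ : 0 < μ)
    (hlam : 0 < lam) :
    ∃! π : State → ℝ, IsStationary (generator (rate α β γ μ lam)) π := by
  have hw := balanceWeight_pos hα hβ hγ hμ hlam
  set w := balanceWeight α β γ μ lam with hw_def
  have hpos : 0 < ∑ y, w y := Finset.sum_pos (fun y _ => hw y) ⟨initialState, by simp⟩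
  have hπ : IsStationary (generator (rate α β γ μ lam)) fun y => w y / ∑ z, w z := by
    refine ⟨fun y => (div_pos (hw y) hpos).le, ?_, ?_⟩
    · rw [← Finset.sum_div, div_self hpos.ne']
    · rw [vecMul_generator_eq_zero_iff hα hβ hγ hμ hlam]
      intro y
      have h1 : w initialState = 1 := by simp [hw_def, balanceWeight, initialState]
      rw [h1]
      ring
  refine ⟨_, hπ, fun π' hπ' => funext fun y => ?_⟩
  obtain ⟨C, -, hC⟩ := exists_abs_sub_le_of_isStationary hα hβ hγ hμ hlam hπ
  have h := hC π' 0 le_rfl hπ'.sum_eq_one (fun j => by simp [hπ'.vecMul_eq_zero]) y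
  rw [mul_zero] at h
  exact sub_eq_zero.1 (abs_nonpos_iff.1 h)

end Stationary

/-! ### Counting paths and driven paths -/

section Paths

variable {m : ℝ≥0 → ℕ} {n : Event → ℝ≥0 → ℕ} {y : ℝ≥0 → State} {s t : ℝ≥0}

theorem not_ticksAt_of_eq (hm : Monotone m) (hst : m t = m s) {u : ℝ≥0} (hsu : s < u)
    (hut : u ≤ t) : ¬ TicksAt m u := fun h =>
  absurd (h.2 s hsu) (not_lt.2 ((hm hut).trans_eq hst))

theorem injOn_setOf_ticksAt (s t : ℝ≥0) :
    Set.InjOn m {u | s < u ∧ u ≤ t ∧ TicksAt m u} := by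
  intro u hu v hv huv
  rcases lt_trichotomy u v with h | h | h
  · exact absurd huv (hv.2.2.2 u h).ne
  · exact h
  · exact absurd huv (hu.2.2.2 v h).ne'

theorem mapsTo_Ioc_setOf_ticksAt (hm : Monotone m) (s t : ℝ≥0) :
    Set.MapsTo m {u | s < u ∧ u ≤ t ∧ TicksAt m u} (Set.Ioc (m s) (m t)) :=
  fun _ hu => ⟨hu.2.2.2 s hu.1, hm hu.2.1⟩

theorem finite_setOf_ticksAt (hm : Monotone m) (s t : ℝ≥0) :
    {u | s < u ∧ u ≤ t ∧ TicksAt m u}.Finite :=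
  Set.Finite.of_injOn (mapsTo_Ioc_setOf_ticksAt hm s t) (injOn_setOf_ticksAt s t)
    (Set.finite_Ioc _ _)

/-- Each point of a counting path raises it by at least one. -/
theorem ncard_setOf_ticksAt_le (hm : Monotone m) (s t : ℝ≥0) :
    {u | s < u ∧ u ≤ t ∧ TicksAt m u}.ncard ≤ m t - m s := by
  have h : (Set.Ioc (m s) (m t)).ncard = m t - m s := by
    rw [← Finset.coe_Ioc, Set.ncard_coe_finset, Nat.card_Ioc]
  rw [← h]
  exact Set.ncard_le_ncard_of_injOn m (mapsTo_Ioc_setOf_ticksAt hm s t)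
    (injOn_setOf_ticksAt s t) (Set.finite_Ioc _ _)

/-- A right-continuous counting path that grows by one over an interval does so in a single jump. -/
theorem exists_jump_of_eq_add_one (hm : Monotone m)
    (hrc : ∀ t, ∀ᶠ s in 𝓝[>] t, m s = m t) (hst : m t = m s + 1) :
    ∃ τ, s < τ ∧ τ ≤ t ∧ (∀ u, s ≤ u → u < τ → m u = m s) ∧ m τ = m t := by
  have hs_le : s ≤ t := by
    by_contra! h
    have := hm h.le
    omega
  -- the jump time is the first time with the new value; right-continuity shows it is attained
  set S : Set ℝ≥0 := {u | s ≤ u ∧ m u = m t} with hS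
  have hne : S.Nonempty := ⟨t, hs_le, rfl⟩
  have hbdd : BddBelow S := OrderBot.bddBelow S
  have hτ : m (sInf S) = m t := by
    obtain ⟨b, hb, hb'⟩ := (mem_nhdsGT_iff_exists_Ioo_subset).1 (hrc (sInf S))
    obtain ⟨u, hu, hub⟩ := exists_lt_of_csInf_lt hne (show sInf S < b from hb)
    rcases (csInf_le hbdd hu).eq_or_lt with h | h
    · rw [h, hu.2]
    · have h1 : m u = m (sInf S) := hb' ⟨h, hub⟩
      rw [← h1, hu.2]
  refine ⟨sInf S, ?_, csInf_le hbdd ⟨hs_le, rfl⟩, fun u hsu hu => ?_, hτ⟩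
  · refine lt_of_le_of_ne (le_csInf hne fun u hu => hu.1) fun h => ?_
    rw [← h] at hτ
    omega
  · have h1 : m u ≠ m t := fun h => absurd (csInf_le hbdd ⟨hsu, h⟩) (not_le.2 hu)
    have h2 := hm hsu
    have h3 := hm hu.le
    omega

theorem HasLeftLimit.eq {a b : State} (ht : 0 < t) (ha : HasLeftLimit y t a)
    (hb : HasLeftLimit y t b) : a = b := by
  have : (𝓝[<] t).NeBot := nhdsLT_neBot_of_exists_lt ⟨0, ht⟩
  obtain ⟨s, h1, h2⟩ := (ha.and hb).exists
  exact h1.symm.trans h2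

/-- Without ticks a driven path is continuous, hence constant, because the state space is
discrete. -/
theorem IsDrivenBy.eq_of_forall_not_ticksAt (hy : IsDrivenBy n y) (hst : s ≤ t)
    (h : ∀ u, s < u → u ≤ t → ∀ c, ¬ TicksAt (n c) u) : y t = y s := by
  have hcont : ContinuousOn y (Set.Icc s t) := by
    intro u hu
    have hright : Tendsto y (𝓝[>] u) (𝓝 (y u)) :=
      tendsto_const_nhds.congr' ((hy.right_cont u).mono fun _ h => h.symm)
    have hIci : ContinuousWithinAt y (Set.Ici u) u :=
      continuousWithinAt_Ioi_iff_Ici.1 hright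
    rcases hu.1.eq_or_lt with rfl | hsu
    · exact hIci.mono Set.Icc_subset_Ici_self
    · obtain ⟨a, ha, -, ha'⟩ := hy.jump u (bot_le.trans_lt hsu)
      rw [← ha' (h u hsu hu.2)] at ha
      have hleft : Tendsto y (𝓝[<] u) (𝓝 (y u)) :=
        tendsto_const_nhds.congr' (ha.mono fun _ h => h.symm)
      have hIic : ContinuousWithinAt y (Set.Iic u) u :=
        continuousWithinAt_Iio_iff_Iic.1 hleft
      exact (continuousAt_iff_continuous_left_right.2 ⟨hIic, hIci⟩).continuousWithinAt
  exact isPreconnected_Icc.constant hcont (Set.right_mem_Icc.2 hst) (Set.left_mem_Icc.2 hst)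

theorem IsDrivenBy.hasLeftLimit_of_forall_not_ticksAt (hy : IsDrivenBy n y) (hst : s < t)
    (h : ∀ u, s < u → u < t → ∀ c, ¬ TicksAt (n c) u) : HasLeftLimit y t (y s) := by
  filter_upwards [Ioo_mem_nhdsLT hst] with u hu
  exact hy.eq_of_forall_not_ticksAt hu.1.le fun v hv hvu => h v hv (hvu.trans_lt hu.2)

end Paths

/-! ### One time step with few ticks -/

section Excess

variable {ι : Type*} [Fintype ι] [DecidableEq ι]

/-- For the vector `ν` of the numbers of ticks of several clocks in a time step: the total number of
ticks if it is at least two, and `0` otherwise. The indicators under the sum cancel the contribution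
of a single tick; this form makes the expectation a finite sum. -/
noncomputable def excess (ν : ι → ℕ) : ℝ := ∑ c, ((ν c : ℝ) - if ν = Pi.single c 1 then 1 else 0)

theorem excess_nonneg (ν : ι → ℕ) : 0 ≤ excess ν := by
  refine Finset.sum_nonneg fun c _ => ?_
  split_ifs with h
  · rw [h]
    simp
  · simp

theorem excess_le_sum (ν : ι → ℕ) : excess ν ≤ ∑ c, (ν c : ℝ) := by
  refine Finset.sum_le_sum fun c _ => ?_
  split_ifs <;> simp

theorem excess_eq_sum {ν : ι → ℕ} (h : ∀ c, ν ≠ Pi.single c 1) : excess ν = ∑ c, (ν c : ℝ) :=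
  Finset.sum_congr rfl fun c _ => by rw [if_neg (h c), sub_zero]

/-- In the last case the sum is at least two, but the lower bound `1` is all that is used. -/
theorem eq_zero_or_eq_single_or_one_le_sum (ν : ι → ℕ) :
    ν = 0 ∨ (∃ c, ν = Pi.single c 1) ∨ (1 ≤ ∑ c, (ν c : ℝ) ∧ ∀ c, ν ≠ Pi.single c 1) := by
  by_cases h0 : ν = 0
  · exact Or.inl h0
  by_cases h1 : ∃ c, ν = Pi.single c 1
  · exact Or.inr (Or.inl h1)
  push Not at h1
  refine Or.inr (Or.inr ⟨?_, h1⟩)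
  obtain ⟨c, hc⟩ := Function.ne_iff.1 h0
  have h2 : 1 ≤ ν c := Nat.one_le_iff_ne_zero.2 hc
  have h3 : ν c ≤ ∑ c, ν c := Finset.single_le_sum (fun _ _ => Nat.zero_le _) (Finset.mem_univ c)
  exact_mod_cast h2.trans h3

end Excess

section Paths

variable {n : Event → ℝ≥0 → ℕ} {y : ℝ≥0 → State} {s t : ℝ≥0}

/-- The times in `(s, t]` of the requests that arrive when the state is in `A`. -/
def requestTimes (n : Event → ℝ≥0 → ℕ) (y : ℝ≥0 → State) (A : Finset State) (s t : ℝ≥0) :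
    Set ℝ≥0 :=
  {u | s < u ∧ u ≤ t ∧ TicksAt (n .request) u ∧ ∃ a ∈ A, HasLeftLimit y u a}

theorem requestTimes_subset (A : Finset State) (s t : ℝ≥0) :
    requestTimes n y A s t ⊆ {u | s < u ∧ u ≤ t ∧ TicksAt (n .request) u} :=
  fun _ hu => ⟨hu.1, hu.2.1, hu.2.2.1⟩

theorem finite_requestTimes (hn : ∀ c, Monotone (n c)) (A : Finset State) (s t : ℝ≥0) :
    (requestTimes n y A s t).Finite :=
  (finite_setOf_ticksAt (hn _) s t).subset (requestTimes_subset A s t)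

theorem ncard_requestTimes_le (hn : ∀ c, Monotone (n c)) (A : Finset State) (s t : ℝ≥0) :
    (requestTimes n y A s t).ncard ≤ n .request t - n .request s :=
  (Set.ncard_le_ncard (requestTimes_subset A s t) (finite_setOf_ticksAt (hn _) s t)).trans
    (ncard_setOf_ticksAt_le (hn _) s t)

theorem ncard_requestTimes_add (hn : ∀ c, Monotone (n c)) (A : Finset State) {r : ℝ≥0}
    (hrs : r ≤ s) (hst : s ≤ t) :
    (requestTimes n y A r t).ncard =
      (requestTimes n y A r s).ncard + (requestTimes n y A s t).ncard := by
  rw [← Set.ncard_union_eq _ (finite_requestTimes hn A r s) (finite_requestTimes hn A s t)]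
  · congr 1
    ext u
    constructor
    · rintro ⟨h1, h2, h3⟩
      rcases le_or_gt u s with h | h
      · exact Or.inl ⟨h1, h, h3⟩
      · exact Or.inr ⟨h, h2, h3⟩
    · rintro (⟨h1, h2, h3⟩ | ⟨h1, h2, h3⟩)
      · exact ⟨h1, h2.trans hst, h3⟩
      · exact ⟨hrs.trans_lt h1, h2, h3⟩
  · exact Set.disjoint_left.2 fun u hu hu' => absurd hu'.1 (not_lt.2 hu.2.1)

/-- If exactly one clock ticks during `(s, t]`, and only once, then the tick finds the state
`y s`. -/
theorem IsDrivenBy.exists_of_single_tick (hy : IsDrivenBy n y) (hn : ∀ c, Monotone (n c))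
    (hrc : ∀ c t, ∀ᶠ s in 𝓝[>] t, n c s = n c t) (hst : s ≤ t) {c : Event}
    (hc : (fun c => n c t - n c s) = Pi.single c 1) :
    ∃ τ, s < τ ∧ τ ≤ t ∧ TicksAt (n c) τ ∧
      (∀ u, s < u → u ≤ t → u ≠ τ → ∀ c', ¬ TicksAt (n c') u) ∧
      HasLeftLimit y τ (y s) ∧ y t = step c (y s) := by
  have hc1 : n c t = n c s + 1 := by
    have h := congr_fun hc c
    simp only [Pi.single_eq_same] at h
    omega
  have hc0 : ∀ c' ≠ c, n c' t = n c' s := by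
    intro c' hc'
    have h := congr_fun hc c'
    simp only [Pi.single_eq_of_ne hc'] at h
    have := hn c' hst
    omega
  obtain ⟨τ, hsτ, hτt, hbefore, hτ⟩ := exists_jump_of_eq_add_one (hn c) (hrc c) hc1
  have htick : TicksAt (n c) τ := by
    refine ⟨bot_le.trans_lt hsτ, fun u hu => ?_⟩
    have h1 : n c u ≤ n c s := by
      rcases le_total s u with h | h
      · exact (hbefore u h hu).le
      · exact hn c h
    omega
  have hno : ∀ u, s < u → u ≤ t → u ≠ τ → ∀ c', ¬ TicksAt (n c') u := by
    intro u hsu hut huτ c'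
    by_cases hc' : c' = c
    · subst hc'
      rcases lt_or_gt_of_ne huτ with h | h
      · exact not_ticksAt_of_eq (hn c') (hbefore u hsu.le h) hsu le_rfl
      · exact not_ticksAt_of_eq (hn c') hτ.symm h hut
    · exact not_ticksAt_of_eq (hn c') (hc0 c' hc') hsu hut
  have hleft : HasLeftLimit y τ (y s) :=
    hy.hasLeftLimit_of_forall_not_ticksAt hsτ fun u hsu huτ =>
      hno u hsu (huτ.le.trans hτt) huτ.ne
  refine ⟨τ, hsτ, hτt, htick, hno, hleft, ?_⟩
  obtain ⟨a, ha, ha', -⟩ := hy.jump τ htick.1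
  rw [hleft.eq htick.1 ha, ← ha' c htick]
  exact hy.eq_of_forall_not_ticksAt hτt fun u hτu hut => hno u (hsτ.trans hτu) hut hτu.ne'

/-- Over a time step the requests that find the state in `A` are all requests or none, according to
the state at the beginning, up to the excess of ticks. -/
theorem IsDrivenBy.abs_ncard_requestTimes_sub_le (hy : IsDrivenBy n y)
    (hn : ∀ c, Monotone (n c)) (hrc : ∀ c t, ∀ᶠ s in 𝓝[>] t, n c s = n c t) (hst : s ≤ t)
    (A : Finset State) :
    |((requestTimes n y A s t).ncard : ℝ)
        - (if y s ∈ A then 1 else 0) * ((n .request t - n .request s : ℕ) : ℝ)|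
      ≤ excess fun c => n c t - n c s := by
  have hle := ncard_requestTimes_le (y := y) hn A s t
  set ν : Event → ℕ := fun c => n c t - n c s with hν
  have hreq : n .request t - n .request s = ν .request := rfl
  rw [hreq] at hle ⊢
  have hzero : ν .request = 0 → |((requestTimes n y A s t).ncard : ℝ)
      - (if y s ∈ A then 1 else 0) * (ν .request : ℝ)| ≤ excess ν := by
    intro h
    rw [h] at hle ⊢
    rw [Nat.le_zero.1 hle]
    simpa using excess_nonneg ν
  rcases eq_zero_or_eq_single_or_one_le_sum ν with h | ⟨c, hc⟩ | ⟨-, h⟩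
  · exact hzero (by rw [h]; rfl)
  · by_cases hcr : c = .request
    · subst hcr
      obtain ⟨τ, hsτ, hτt, htick, hno, hleft, -⟩ := hy.exists_of_single_tick hn hrc hst hc
      have hcard : (requestTimes n y A s t).ncard = if y s ∈ A then 1 else 0 := by
        split_ifs with hA
        · rw [Set.ncard_eq_one]
          refine ⟨τ, Set.Subset.antisymm (fun u hu => ?_) ?_⟩
          · by_contra hne
            exact hno u hu.1 hu.2.1 hne _ hu.2.2.1
          · intro u hu
            rw [Set.mem_singleton_iff.1 hu]
            exact ⟨hsτ, hτt, htick, y s, hA, hleft⟩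
        · rw [Set.ncard_eq_zero (finite_requestTimes hn A s t), Set.eq_empty_iff_forall_notMem]
          rintro u ⟨h1, h2, h3, a, ha, ha'⟩
          have huτ : u = τ := by
            by_contra hne
            exact hno u h1 h2 hne _ h3
          subst huτ
          exact hA (hleft.eq h3.1 ha' ▸ ha)
      have h1 : ν .request = 1 := by rw [hc, Pi.single_eq_same]
      rw [hcard, h1]
      simpa using excess_nonneg ν
    · exact hzero (by rw [hc, Pi.single_eq_of_ne (Ne.symm hcr)])
  · rw [excess_eq_sum h]
    have h1 : (ν .request : ℝ) ≤ ∑ c, (ν c : ℝ) :=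
      Finset.single_le_sum (f := fun c => (ν c : ℝ)) (fun _ _ => Nat.cast_nonneg _)
        (Finset.mem_univ _)
    refine le_trans ?_ h1
    have h2 : ((requestTimes n y A s t).ncard : ℝ) ≤ ν .request := by exact_mod_cast hle
    have h3 : (0 : ℝ) ≤ (requestTimes n y A s t).ncard := Nat.cast_nonneg _
    have h4 : (0 : ℝ) ≤ ν .request := Nat.cast_nonneg _
    rw [abs_le]
    split_ifs <;> constructor <;> linarith

/-- The change of an observable over a time step is the sum of the changes due to the ticks, each
evaluated at the state at the beginning, up to the excess of ticks. -/
theorem IsDrivenBy.abs_sub_sub_sum_le (hy : IsDrivenBy n y)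
    (hn : ∀ c, Monotone (n c)) (hrc : ∀ c t, ∀ᶠ s in 𝓝[>] t, n c s = n c t) (hst : s ≤ t)
    {f : State → ℝ} (hf0 : ∀ x, 0 ≤ f x) (hf1 : ∀ x, f x ≤ 1) :
    |f (y t) - f (y s)
        - ∑ c, (f (step c (y s)) - f (y s)) * ((n c t - n c s : ℕ) : ℝ)|
      ≤ 2 * excess fun c => n c t - n c s := by
  set ν : Event → ℕ := fun c => n c t - n c s with hν
  change |f (y t) - f (y s) - ∑ c, (f (step c (y s)) - f (y s)) * (ν c : ℝ)| ≤ 2 * excess ν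
  have hexc := excess_nonneg ν
  rcases eq_zero_or_eq_single_or_one_le_sum ν with h | ⟨c, hc⟩ | ⟨hν1, h⟩
  · have hconst : y t = y s := by
      refine hy.eq_of_forall_not_ticksAt hst fun u hsu hut c => ?_
      refine not_ticksAt_of_eq (hn c) (le_antisymm ?_ (hn c hst)) hsu hut
      exact Nat.sub_eq_zero_iff_le.1 (congr_fun h c)
    rw [hconst, h]
    rw [h] at hexc
    simpa using hexc
  · obtain ⟨τ, -, -, -, -, -, hyt⟩ := hy.exists_of_single_tick hn hrc hst hc
    have h1 : ∑ c', (f (step c' (y s)) - f (y s)) * (ν c' : ℝ) = f (step c (y s)) - f (y s) := by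
      rw [Finset.sum_eq_single c]
      · rw [hc, Pi.single_eq_same, Nat.cast_one, mul_one]
      · intro c' _ hc'
        rw [hc, Pi.single_eq_of_ne hc', Nat.cast_zero, mul_zero]
      · exact fun h => absurd (Finset.mem_univ c) h
    rw [h1, hyt, sub_self, abs_zero]
    linarith
  · rw [excess_eq_sum h]
    have hdiff : ∀ a b, |f a - f b| ≤ 1 := fun a b => by
      rw [abs_le]
      constructor <;> linarith [hf0 a, hf0 b, hf1 a, hf1 b]
    have h1 : |∑ c, (f (step c (y s)) - f (y s)) * (ν c : ℝ)| ≤ ∑ c, (ν c : ℝ) := by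
      refine (Finset.abs_sum_le_sum_abs _ _).trans (Finset.sum_le_sum fun c _ => ?_)
      rw [abs_mul, Nat.abs_cast]
      exact mul_le_of_le_one_left (Nat.cast_nonneg _) (hdiff _ _)
    calc _ ≤ |f (y t) - f (y s)| + |∑ c, (f (step c (y s)) - f (y s)) * (ν c : ℝ)| := abs_sub _ _
      _ ≤ 1 + ∑ c, (ν c : ℝ) := add_le_add (hdiff _ _) h1
      _ ≤ 2 * ∑ c, (ν c : ℝ) := by linarith

end Paths

/-! ### A law of large numbers for thinned increments -/

/-- A difference of monotone sequences, one of which has bounded increments, is `o(n)` as soon as it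
is so along the squares. -/
theorem tendsto_sub_div_of_tendsto_sq {u v : ℕ → ℝ} {c : ℝ} (hc : 0 ≤ c) (hu : Monotone u)
    (hv : Monotone v) (hvc : ∀ i j, i ≤ j → v j - v i ≤ c * ((j : ℝ) - i))
    (h : Tendsto (fun j : ℕ => (u (j ^ 2) - v (j ^ 2)) / (j : ℝ) ^ 2) atTop (𝓝 0)) :
    Tendsto (fun n : ℕ => (u n - v n) / (n : ℝ)) atTop (𝓝 0) := by
  have hsqrt : Tendsto Nat.sqrt atTop atTop :=
    tendsto_atTop.2 fun b => (eventually_ge_atTop (b ^ 2)).mono fun n hn => Nat.le_sqrt'.2 hn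
  have hg : Tendsto (fun j : ℕ => |(u (j ^ 2) - v (j ^ 2)) / (j : ℝ) ^ 2|
      + 4 * |(u ((j + 1) ^ 2) - v ((j + 1) ^ 2)) / ((j + 1 : ℕ) : ℝ) ^ 2| + 3 * c / j)
      atTop (𝓝 0) := by
    have h1 := h.abs
    have h2 := ((h.comp (tendsto_add_atTop_nat 1)).abs).const_mul 4
    have h3 := tendsto_const_div_atTop_nhds_zero_nat (3 * c)
    simpa using (h1.add h2).add h3
  refine squeeze_zero_norm' ?_ (hg.comp hsqrt)
  filter_upwards [eventually_ge_atTop 1] with n hn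
  simp only [Function.comp_apply, Real.norm_eq_abs]
  set j := Nat.sqrt n with hj
  have hj1 : 1 ≤ j := Nat.le_sqrt'.2 (by simpa using hn)
  have hjn : j ^ 2 ≤ n := Nat.sqrt_le' n
  have hnj : n ≤ (j + 1) ^ 2 := (Nat.lt_succ_sqrt' n).le
  have hj1' : (1 : ℝ) ≤ j := by exact_mod_cast hj1
  have hj0 : (0 : ℝ) < j := by linarith
  have hjn' : (j : ℝ) ^ 2 ≤ n := by exact_mod_cast hjn
  have hn0 : (0 : ℝ) < n := by exact_mod_cast hn
  have hgap : v ((j + 1) ^ 2) - v (j ^ 2) ≤ 3 * c * j := by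
    refine (hvc _ _ (by gcongr; omega)).trans ?_
    push_cast
    nlinarith
  have hbound : |u n - v n| ≤ |u (j ^ 2) - v (j ^ 2)| + |u ((j + 1) ^ 2) - v ((j + 1) ^ 2)|
      + 3 * c * j := by
    have h1 := hu hjn
    have h2 := hu hnj
    have h3 := hv hjn
    have h4 := hv hnj
    have h5 := le_abs_self (u ((j + 1) ^ 2) - v ((j + 1) ^ 2))
    have h6 := neg_abs_le (u (j ^ 2) - v (j ^ 2))
    have h7 := abs_nonneg (u ((j + 1) ^ 2) - v ((j + 1) ^ 2))
    have h8 := abs_nonneg (u (j ^ 2) - v (j ^ 2))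
    rw [abs_le]
    constructor <;> linarith
  have hj2 : (((j + 1 : ℕ) : ℝ)) ^ 2 ≤ 4 * (j : ℝ) ^ 2 := by
    push_cast
    nlinarith
  rw [abs_div, abs_div, abs_div, abs_of_pos hn0, abs_of_pos (pow_pos hj0 2),
    abs_of_pos (by positivity : (0 : ℝ) < (((j + 1 : ℕ) : ℝ)) ^ 2)]
  calc |u n - v n| / n
      ≤ (|u (j ^ 2) - v (j ^ 2)| + |u ((j + 1) ^ 2) - v ((j + 1) ^ 2)| + 3 * c * j)
          / (j : ℝ) ^ 2 := div_le_div₀ (by positivity) hbound (by positivity) hjn'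
    _ = |u (j ^ 2) - v (j ^ 2)| / (j : ℝ) ^ 2
          + 4 * (|u ((j + 1) ^ 2) - v ((j + 1) ^ 2)| / (4 * (j : ℝ) ^ 2)) + 3 * c / j := by
        field_simp
    _ ≤ _ := by gcongr

/-- Strong law of large numbers for nonnegative variables `ξ k` with a common mean and bounded second
moments, each independent of the past, thinned by a predictable factor. The centred summands are
orthogonal, so the second moment of the `n`-th partial sum is `O(n)`; this is summable along the
squares after normalization, and the gaps are filled by monotonicity. -/
theorem ae_tendsto_sum_mul_sub_div {Ω : Type*} {mΩ : MeasurableSpace Ω} {P : Measure Ω}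
    [IsProbabilityMeasure P] (𝓖 : Filtration ℕ mΩ) {A ξ : ℕ → Ω → ℝ} {c C : ℝ}
    (hA : ∀ k, Measurable[𝓖 k] (A k)) (hA0 : ∀ k ω, 0 ≤ A k ω) (hA1 : ∀ k ω, A k ω ≤ 1)
    (hξ : ∀ k, Measurable[𝓖 (k + 1)] (ξ k)) (hξ0 : ∀ k ω, 0 ≤ ξ k ω)
    (hind : ∀ k, Indep (MeasurableSpace.comap (ξ k) inferInstance) (𝓖 k) P)
    (hL2 : ∀ k, MemLp (ξ k) 2 P) (hmean : ∀ k, ∫ ω, ξ k ω ∂P = c)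
    (hsq : ∀ k, ∫ ω, ξ k ω ^ 2 ∂P ≤ C) :
    ∀ᵐ ω ∂P, Tendsto (fun n : ℕ => (∑ k ∈ Finset.range n, A k ω * (ξ k ω - c)) / (n : ℝ))
      atTop (𝓝 0) := by
  have hc : 0 ≤ c := hmean 0 ▸ integral_nonneg (hξ0 0)
  have hAm : ∀ k, Measurable (A k) := fun k => (hA k).mono (𝓖.le k) le_rfl
  have hcent : ∀ k, MemLp (fun ω => ξ k ω - c) 2 P := fun k => (hL2 k).sub (memLp_const c)
  have hX : ∀ k, MemLp (fun ω => A k ω * (ξ k ω - c)) 2 P := fun k => by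
    refine (hcent k).mono ((hAm k).aestronglyMeasurable.mul (hcent k).1) (ae_of_all _ fun ω => ?_)
    rw [norm_mul, Real.norm_eq_abs, abs_of_nonneg (hA0 k ω)]
    exact mul_le_of_le_one_left (norm_nonneg _) (hA1 k ω)
  set S : ℕ → Ω → ℝ := fun n ω => ∑ k ∈ Finset.range n, A k ω * (ξ k ω - c) with hS
  have hSL : ∀ n, MemLp (S n) 2 P := fun n => memLp_finsetSum _ fun k _ => hX k
  have hSm : ∀ n, Measurable[𝓖 n] (S n) := fun n => by
    refine Finset.measurable_fun_sum _ fun k hk => ?_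
    have hk' : k + 1 ≤ n := Finset.mem_range.1 hk
    have h1 : Measurable[𝓖 n] (A k) := (hA k).mono (𝓖.mono (by omega)) le_rfl
    have h2 : Measurable[𝓖 n] (ξ k) := (hξ k).mono (𝓖.mono hk') le_rfl
    exact h1.mul (h2.sub_const c)
  have hcent_sq : ∀ k, ∫ ω, (A k ω * (ξ k ω - c)) ^ 2 ∂P ≤ C := fun k => by
    have h1 : ∫ ω, (A k ω * (ξ k ω - c)) ^ 2 ∂P ≤ ∫ ω, (ξ k ω - c) ^ 2 ∂P := by
      refine integral_mono (hX k).integrable_sq (hcent k).integrable_sq fun ω => ?_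
      dsimp only
      rw [mul_pow]
      exact mul_le_of_le_one_left (sq_nonneg _) (pow_le_one₀ (hA0 k ω) (hA1 k ω))
    have h2 : ∫ ω, (ξ k ω - c) ^ 2 ∂P = ∫ ω, ξ k ω ^ 2 ∂P - c ^ 2 := by
      have hi := (hL2 k).integrable (by norm_num)
      have : ∀ ω, (ξ k ω - c) ^ 2 = ξ k ω ^ 2 - 2 * c * ξ k ω + c ^ 2 := fun ω => by ring
      have hi' : Integrable (fun ω => ξ k ω ^ 2 - 2 * c * ξ k ω) P :=
        (hL2 k).integrable_sq.sub (hi.const_mul _)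
      simp_rw [this]
      rw [integral_add hi' (integrable_const _),
        integral_sub (hL2 k).integrable_sq (hi.const_mul _), integral_const_mul, hmean]
      simp
      ring
    have := hsq k
    nlinarith [sq_nonneg c]
  have hsecond : ∀ n : ℕ, ∫ ω, S n ω ^ 2 ∂P ≤ n * C := by
    intro n
    induction n with
    | zero => simp [hS]
    | succ n ih =>
      -- the increment is centred and independent of the past, so the cross term vanishes
      have hcross : ∫ ω, S n ω * A n ω * (ξ n ω - c) ∂P = 0 := by
        have hi : IndepFun (fun ω => S n ω * A n ω) (fun ω => ξ n ω - c) P := by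
          rw [IndepFun_iff_Indep]
          refine indep_of_indep_of_le_left (indep_of_indep_of_le_right (hind n).symm ?_) ?_
          · exact ((comap_measurable (ξ n)).sub_const c).comap_le
          · exact ((hSm n).mul (hA n)).comap_le
        have h1 := hi.integral_fun_mul_eq_mul_integral
          ((hSL n).1.mul (hAm n).aestronglyMeasurable) (hcent n).1
        rw [h1, integral_sub ((hL2 n).integrable (by norm_num)) (integrable_const _), hmean]
        simp
      have hexp : ∀ ω, S (n + 1) ω ^ 2
          = S n ω ^ 2 + 2 * (S n ω * A n ω * (ξ n ω - c)) + (A n ω * (ξ n ω - c)) ^ 2 := by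
        intro ω
        simp only [hS, Finset.sum_range_succ]
        ring
      have hi : Integrable (fun ω => S n ω * A n ω * (ξ n ω - c)) P := by
        refine ((hSL n).integrable_mul (hX n)).congr (ae_of_all _ fun ω => ?_)
        exact (mul_assoc _ _ _).symm
      have hi' : Integrable (fun ω => S n ω ^ 2 + 2 * (S n ω * A n ω * (ξ n ω - c))) P :=
        (hSL n).integrable_sq.add (hi.const_mul 2)
      simp_rw [hexp]
      rw [integral_add hi' (hX n).integrable_sq,
        integral_add (hSL n).integrable_sq (hi.const_mul 2), integral_const_mul, hcross]
      push_cast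
      linarith [hcent_sq n]
  -- along the squares the second moments are summable, hence so are the squares themselves, a.s.
  have hsub : ∀ᵐ ω ∂P, Tendsto (fun j : ℕ => S (j ^ 2) ω / (j : ℝ) ^ 2) atTop (𝓝 0) := by
    have hint : ∀ j : ℕ, Integrable (fun ω => (S (j ^ 2) ω / (j : ℝ) ^ 2) ^ 2) P := fun j => by
      simp_rw [div_pow]
      exact (hSL _).integrable_sq.div_const _
    have hle : ∀ j : ℕ, ∫ ω, (S (j ^ 2) ω / (j : ℝ) ^ 2) ^ 2 ∂P ≤ C * (1 / (j : ℝ) ^ 2) := by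
      intro j
      simp_rw [div_pow]
      rw [integral_div]
      rcases Nat.eq_zero_or_pos j with rfl | hj
      · simp
      · have hj' : (0 : ℝ) < j := by exact_mod_cast hj
        have := hsecond (j ^ 2)
        push_cast at this
        rw [div_le_iff₀ (by positivity)]
        refine this.trans (le_of_eq ?_)
        field_simp
    have hsum : ∑' j : ℕ, ∫⁻ ω, ENNReal.ofReal ((S (j ^ 2) ω / (j : ℝ) ^ 2) ^ 2) ∂P ≠ ⊤ := by
      have hsm : Summable fun j : ℕ => C * (1 / (j : ℝ) ^ 2) :=
        (Real.summable_one_div_nat_pow.2 one_lt_two).mul_left C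
      refine ne_top_of_le_ne_top hsm.tsum_ofReal_ne_top (ENNReal.tsum_le_tsum fun j => ?_)
      rw [← ofReal_integral_eq_lintegral_ofReal (hint j) (ae_of_all _ fun ω => sq_nonneg _)]
      exact ENNReal.ofReal_le_ofReal (hle j)
    have hmeas : ∀ j : ℕ,
        AEMeasurable (fun ω => ENNReal.ofReal ((S (j ^ 2) ω / (j : ℝ) ^ 2) ^ 2)) P :=
      fun j => (hint j).1.aemeasurable.ennreal_ofReal
    rw [← lintegral_tsum hmeas] at hsum
    filter_upwards [ae_lt_top' (AEMeasurable.tsum hmeas) hsum] with ω hω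
    have h1 := ENNReal.tendsto_atTop_zero_of_tsum_ne_top hω.ne
    have h2 := (ENNReal.tendsto_toReal ENNReal.zero_ne_top).comp h1
    have h3 : Tendsto (fun j : ℕ => (S (j ^ 2) ω / (j : ℝ) ^ 2) ^ 2) atTop (𝓝 0) := by
      refine h2.congr fun j => ?_
      simp only [Function.comp_apply]
      exact ENNReal.toReal_ofReal (sq_nonneg _)
    have h4 := h3.sqrt
    rw [Real.sqrt_zero] at h4
    simp_rw [Real.sqrt_sq_eq_abs] at h4
    exact (tendsto_zero_iff_abs_tendsto_zero _).2 h4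
  filter_upwards [hsub] with ω hω
  have hsplit : ∀ n, S n ω = ∑ k ∈ Finset.range n, A k ω * ξ k ω
      - ∑ k ∈ Finset.range n, A k ω * c := fun n => by
    rw [← Finset.sum_sub_distrib]
    exact Finset.sum_congr rfl fun k _ => by ring
  simp_rw [hsplit] at hω
  change Tendsto (fun n : ℕ => S n ω / (n : ℝ)) atTop (𝓝 0)
  simp_rw [hsplit]
  -- thinned sum and compensator are both monotone, as `tendsto_sub_div_of_tendsto_sq` requires
  refine tendsto_sub_div_of_tendsto_sq hc ?_ ?_ ?_ hω
  · exact monotone_nat_of_le_succ fun n => by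
      rw [Finset.sum_range_succ]
      exact le_add_of_nonneg_right (mul_nonneg (hA0 n ω) (hξ0 n ω))
  · exact monotone_nat_of_le_succ fun n => by
      rw [Finset.sum_range_succ]
      exact le_add_of_nonneg_right (mul_nonneg (hA0 n ω) hc)
  · intro i j hij
    rw [← Finset.sum_Ico_eq_sub _ hij]
    calc ∑ k ∈ Finset.Ico i j, A k ω * c ≤ ∑ k ∈ Finset.Ico i j, c :=
          Finset.sum_le_sum fun k _ => mul_le_of_le_one_left hc (hA1 k ω)
      _ = c * ((j : ℝ) - i) := by
          rw [Finset.sum_const, Nat.card_Ico, nsmul_eq_mul, Nat.cast_sub hij, mul_comm]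

/-! ### Moments of Poisson increments -/

theorem memLp_two_natCast_poissonMeasure (r : ℝ≥0) :
    MemLp (fun n : ℕ => (n : ℝ)) 2 (poissonMeasure r) := by
  rw [memLp_two_iff_integrable_sq .of_discrete, integrable_poissonMeasure_iff]
  refine Summable.of_nonneg_of_le (fun n => by positivity) (fun n => ?_)
    ((Real.summable_pow_div_factorial (4 * r : ℝ)).mul_left (Real.exp (-r)))
  have h1 : (n : ℝ) ≤ 2 ^ n := by exact_mod_cast Nat.lt_two_pow_self.le
  have h2 : (n : ℝ) ^ 2 ≤ 4 ^ n := by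
    calc (n : ℝ) ^ 2 ≤ (2 ^ n) ^ 2 := by gcongr
      _ = 4 ^ n := by rw [← pow_mul, mul_comm, pow_mul]; norm_num
  rw [Real.norm_of_nonneg (by positivity), mul_pow]
  calc Real.exp (-r) * r ^ n / n.factorial * (n : ℝ) ^ 2
      ≤ Real.exp (-r) * r ^ n / n.factorial * 4 ^ n := by gcongr
    _ = _ := by ring

theorem integral_natCast_poissonMeasure (r : ℝ≥0) :
    ∫ n : ℕ, (n : ℝ) ∂poissonMeasure r = r := by
  have hsum : HasSum (fun n : ℕ => (Real.exp (-r) * r ^ n / n.factorial) • (n : ℝ)) (r : ℝ) := by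
    rw [← hasSum_nat_add_iff' 1]
    have h := (hasSum_one_poissonMeasure r).mul_left (r : ℝ)
    simp only [Finset.range_one, Finset.sum_singleton, Nat.cast_zero, smul_zero, sub_zero]
    rw [mul_one] at h
    refine h.congr_fun fun n => ?_
    rw [Nat.factorial_succ, smul_eq_mul]
    push_cast
    field_simp
    ring
  rw [integral_poissonMeasure, hsum.tsum_eq]

namespace IsPoissonFamily

variable {Ω ι : Type*} {mΩ : MeasurableSpace Ω} {P : Measure Ω} {𝓕 : Filtration ℝ≥0 mΩ}
  {r : ι → ℝ≥0} {N : ι → ℝ≥0 → Ω → ℕ} {s t : ℝ≥0}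

theorem measurable_increment (hN : IsPoissonFamily P 𝓕 r N) (c : ι) (hst : s ≤ t) :
    Measurable[𝓕 t] fun ω => N c t ω - N c s ω :=
  (hN.adapted c t).sub ((hN.adapted c s).mono (𝓕.mono hst) le_rfl)

theorem measurable_increment' (hN : IsPoissonFamily P 𝓕 r N) (c : ι) (hst : s ≤ t) :
    Measurable fun ω => N c t ω - N c s ω :=
  (hN.measurable_increment c hst).mono (𝓕.le t) le_rfl

theorem memLp_increment (hN : IsPoissonFamily P 𝓕 r N) (c : ι) (hst : s ≤ t) :
    MemLp (fun ω => ((N c t ω - N c s ω : ℕ) : ℝ)) 2 P := by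
  have h := memLp_two_natCast_poissonMeasure (r c * (t - s))
  rw [← hN.law c s t hst] at h
  exact (memLp_map_measure_iff .of_discrete (hN.measurable_increment' c hst).aemeasurable).1 h

theorem integral_increment (hN : IsPoissonFamily P 𝓕 r N) (c : ι) (hst : s ≤ t) :
    ∫ ω, ((N c t ω - N c s ω : ℕ) : ℝ) ∂P = r c * (t - s : ℝ≥0) := by
  have h := integral_natCast_poissonMeasure (r c * (t - s))
  rw [← hN.law c s t hst,
    integral_map (hN.measurable_increment' c hst).aemeasurable .of_discrete] at h
  rw [h, NNReal.coe_mul]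

theorem integral_increment_sq (hN : IsPoissonFamily P 𝓕 r N) (c : ι) (hst : s ≤ t) :
    ∫ ω, ((N c t ω - N c s ω : ℕ) : ℝ) ^ 2 ∂P
      = ∫ n : ℕ, (n : ℝ) ^ 2 ∂poissonMeasure (r c * (t - s)) := by
  rw [← hN.law c s t hst,
    integral_map (hN.measurable_increment' c hst).aemeasurable .of_discrete]

variable [Fintype ι] [DecidableEq ι]

/-- The probability that exactly one clock ticks, once, and that it is the clock `c`. -/
theorem measureReal_increment_eq_single (hN : IsPoissonFamily P 𝓕 r N) (c : ι) (hst : s ≤ t) :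
    P.real {ω | (fun c => N c t ω - N c s ω) = Pi.single c 1}
      = r c * (t - s : ℝ≥0) * Real.exp (-((∑ c, (r c : ℝ)) * (t - s : ℝ≥0))) := by
  have hset : {ω | (fun c => N c t ω - N c s ω) = Pi.single c 1}
      = ⋂ c' ∈ (Finset.univ : Finset ι),
        (fun ω => N c' t ω - N c' s ω) ⁻¹' {(Pi.single c 1 : ι → ℕ) c'} := by
    ext ω
    simp [funext_iff]
  have hprob : ∀ c', P.real ((fun ω => N c' t ω - N c' s ω) ⁻¹' {(Pi.single c 1 : ι → ℕ) c'})
      = Real.exp (-(r c' * (t - s : ℝ≥0))) * if c' = c then (r c * (t - s : ℝ≥0) : ℝ) else 1 := by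
    intro c'
    rw [← map_measureReal_apply (hN.measurable_increment' c' hst) (measurableSet_singleton _),
      hN.law c' s t hst, poissonMeasure_real_singleton]
    split_ifs with h
    · subst h
      simp
    · rw [Pi.single_eq_of_ne h]
      simp
  rw [hset, measureReal_def, (iIndepFun_iff_measure_inter_preimage_eq_mul.1 (hN.indep s t hst))
    Finset.univ fun _ _ => measurableSet_singleton _, ENNReal.toReal_prod]
  simp_rw [← measureReal_def, hprob]
  rw [Finset.prod_mul_distrib, Finset.prod_ite_eq' Finset.univ c, if_pos (Finset.mem_univ c),
    ← Real.exp_sum, Finset.sum_neg_distrib, Finset.sum_mul, mul_comm]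

theorem measurable_excess : Measurable (excess : (ι → ℕ) → ℝ) := by
  refine Finset.measurable_fun_sum _ fun c _ => ?_
  refine Measurable.sub ?_ ?_
  · exact (measurable_from_top (f := fun n : ℕ => (n : ℝ))).comp (measurable_pi_apply c)
  · exact Measurable.ite (measurableSet_singleton _) measurable_const measurable_const

omit [DecidableEq ι] in
theorem memLp_sum_increment (hN : IsPoissonFamily P 𝓕 r N) (hst : s ≤ t) :
    MemLp (fun ω => ∑ c, ((N c t ω - N c s ω : ℕ) : ℝ)) 2 P :=
  memLp_finsetSum _ fun c _ => hN.memLp_increment c hst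

theorem memLp_excess (hN : IsPoissonFamily P 𝓕 r N) (hst : s ≤ t) :
    MemLp (fun ω => excess fun c => N c t ω - N c s ω) 2 P := by
  refine (hN.memLp_sum_increment hst).mono ?_ (ae_of_all _ fun ω => ?_)
  · exact (measurable_excess.comp
      (measurable_pi_lambda _ fun c => hN.measurable_increment' c hst)).aestronglyMeasurable
  · rw [Real.norm_of_nonneg (excess_nonneg _)]
    exact (excess_le_sum _).trans (le_abs_self _)

theorem integral_excess_sq_le (hN : IsPoissonFamily P 𝓕 r N) (hst : s ≤ t) :
    ∫ ω, (excess fun c => N c t ω - N c s ω) ^ 2 ∂P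
      ≤ Fintype.card ι * ∑ c, ∫ n : ℕ, (n : ℝ) ^ 2 ∂poissonMeasure (r c * (t - s)) := by
  simp_rw [← hN.integral_increment_sq _ hst]
  have hint : ∀ c, Integrable (fun ω => ((N c t ω - N c s ω : ℕ) : ℝ) ^ 2) P :=
    fun c => (hN.memLp_increment c hst).integrable_sq
  rw [← integral_finsetSum _ fun c _ => hint c, ← integral_const_mul]
  refine integral_mono (hN.memLp_excess hst).integrable_sq
    ((integrable_finsetSum _ fun c _ => hint c).const_mul _) fun ω => ?_
  calc (excess fun c => N c t ω - N c s ω) ^ 2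
      ≤ (∑ c, ((N c t ω - N c s ω : ℕ) : ℝ)) ^ 2 :=
        pow_le_pow_left₀ (excess_nonneg _) (excess_le_sum _) 2
    _ ≤ _ := sq_sum_le_card_mul_sum_sq

theorem integral_excess [IsProbabilityMeasure P] (hN : IsPoissonFamily P 𝓕 r N) (hst : s ≤ t) :
    ∫ ω, (excess fun c => N c t ω - N c s ω) ∂P
      = (∑ c, (r c : ℝ)) * (t - s : ℝ≥0)
        * (1 - Real.exp (-((∑ c, (r c : ℝ)) * (t - s : ℝ≥0)))) := by
  have hmeas : ∀ c, MeasurableSet {ω | (fun c => N c t ω - N c s ω) = Pi.single c 1} := fun c =>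
    (measurable_pi_lambda _ fun c => hN.measurable_increment' c hst) (measurableSet_singleton _)
  have hind : ∀ c, (fun ω => if (fun c => N c t ω - N c s ω) = Pi.single c 1 then (1 : ℝ) else 0)
      = {ω | (fun c => N c t ω - N c s ω) = Pi.single c 1}.indicator 1 := fun c => by
    ext ω
    simp [Set.indicator_apply]
  have hint1 : ∀ c, Integrable (fun ω => ((N c t ω - N c s ω : ℕ) : ℝ)) P :=
    fun c => (hN.memLp_increment c hst).integrable (by norm_num)
  have hint2 : ∀ c, Integrable
      (fun ω => if (fun c => N c t ω - N c s ω) = Pi.single c 1 then (1 : ℝ) else 0) P :=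
    fun c => by
      rw [hind]
      exact (integrable_const 1).indicator (hmeas c)
  have hterm : ∀ c, ∫ ω, (((N c t ω - N c s ω : ℕ) : ℝ)
      - if (fun c => N c t ω - N c s ω) = Pi.single c 1 then (1 : ℝ) else 0) ∂P
      = r c * ((t - s : ℝ≥0) * (1 - Real.exp (-((∑ c, (r c : ℝ)) * (t - s : ℝ≥0))))) := by
    intro c
    rw [integral_sub (hint1 c) (hint2 c), hN.integral_increment c hst, hind,
      integral_indicator_one (hmeas c), hN.measureReal_increment_eq_single c hst]
    ring
  unfold excess
  rw [integral_finsetSum _ fun c _ => by exact (hint1 c).sub (hint2 c),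
    Finset.sum_congr rfl fun c _ => hterm c, ← Finset.sum_mul, mul_assoc]

/-- The filtration observed at the times `k * h` of the grid of mesh `h`. -/
def gridFiltration (𝓕 : Filtration ℝ≥0 mΩ) (h : ℝ≥0) : Filtration ℕ mΩ where
  seq k := 𝓕 (k * h)
  mono' i j hij := 𝓕.mono (by gcongr)
  le' k := 𝓕.le _

omit [Fintype ι] [DecidableEq ι] in
/-- The ticks of a clock that are selected by a factor known at the beginning of each step occur at
the rate of the clock. -/
theorem ae_tendsto_thinned_increment [IsProbabilityMeasure P] (hN : IsPoissonFamily P 𝓕 r N)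
    (h : ℝ≥0) (c : ι) {A : ℕ → Ω → ℝ} (hA : ∀ k : ℕ, Measurable[𝓕 (k * h)] (A k))
    (hA0 : ∀ k ω, 0 ≤ A k ω) (hA1 : ∀ k ω, A k ω ≤ 1) :
    ∀ᵐ ω ∂P, Tendsto (fun n : ℕ => (∑ k ∈ Finset.range n, A k ω *
      (((N c ((k + 1 : ℕ) * h) ω - N c (k * h) ω : ℕ) : ℝ) - r c * h)) / (n : ℝ))
      atTop (𝓝 0) := by
  have hle : ∀ k : ℕ, (k : ℝ≥0) * h ≤ (k + 1 : ℕ) * h := fun k => by gcongr; simp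
  have hsub : ∀ k : ℕ, ((k + 1 : ℕ) : ℝ≥0) * h - k * h = h := fun k => by
    rw [← tsub_mul]; simp
  refine ae_tendsto_sum_mul_sub_div (gridFiltration 𝓕 h) hA hA0 hA1 (fun k => ?_)
    (fun k ω => Nat.cast_nonneg _) (fun k => ?_) (fun k => hN.memLp_increment c (hle k))
    (fun k => ?_) (fun k => ?_)
    (C := ∫ n : ℕ, (n : ℝ) ^ 2 ∂poissonMeasure (r c * h))
  · exact measurable_from_top.comp (hN.measurable_increment c (hle k))
  · refine indep_of_indep_of_le_left (hN.indep_past _ _ (hle k)) ?_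
    have hcoord : Measurable fun ν : ι → ℕ => (ν c : ℝ) :=
      (measurable_from_top (f := fun n : ℕ => (n : ℝ))).comp (measurable_pi_apply c)
    exact (hcoord.comp (comap_measurable
      fun ω c => N c ((k + 1 : ℕ) * h) ω - N c (k * h) ω)).comap_le
  · rw [hN.integral_increment c (hle k), hsub]
  · rw [hN.integral_increment_sq c (hle k), hsub]

/-- The limit is `O(h ^ 2)`, although the number of ticks per step has mean of order `h`. -/
theorem ae_tendsto_excess [IsProbabilityMeasure P] (hN : IsPoissonFamily P 𝓕 r N) (h : ℝ≥0) :
    ∀ᵐ ω ∂P, Tendsto (fun n : ℕ => (∑ k ∈ Finset.range n,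
      excess fun c => N c ((k + 1 : ℕ) * h) ω - N c (k * h) ω) / (n : ℝ))
      atTop (𝓝 ((∑ c, (r c : ℝ)) * h * (1 - Real.exp (-((∑ c, (r c : ℝ)) * h))))) := by
  have hle : ∀ k : ℕ, (k : ℝ≥0) * h ≤ (k + 1 : ℕ) * h := fun k => by gcongr; simp
  have hsub : ∀ k : ℕ, ((k + 1 : ℕ) : ℝ≥0) * h - k * h = h := fun k => by
    rw [← tsub_mul]; simp
  set e : ℝ := (∑ c, (r c : ℝ)) * h * (1 - Real.exp (-((∑ c, (r c : ℝ)) * h))) with he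
  have key := ae_tendsto_sum_mul_sub_div (P := P) (gridFiltration 𝓕 h) (A := fun _ _ => 1)
    (ξ := fun k ω => excess fun c => N c ((k + 1 : ℕ) * h) ω - N c (k * h) ω) (c := e)
    (C := Fintype.card ι * ∑ c, ∫ n : ℕ, (n : ℝ) ^ 2 ∂poissonMeasure (r c * h))
    (fun k => measurable_const) (fun k ω => zero_le_one) (fun k ω => le_rfl) (fun k => ?_)
    (fun k ω => excess_nonneg _) (fun k => ?_) (fun k => hN.memLp_excess (hle k))
    (fun k => ?_) (fun k => ?_)
  · filter_upwards [key] with ω hω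
    have h1 := hω.add_const e
    rw [zero_add] at h1
    refine h1.congr' ?_
    filter_upwards [eventually_ge_atTop 1] with n hn
    have hn0 : (n : ℝ) ≠ 0 := by positivity
    simp only [one_mul, Finset.sum_sub_distrib, Finset.sum_const, Finset.card_range, nsmul_eq_mul]
    rw [sub_div, mul_div_cancel_left₀ _ hn0, sub_add_cancel]
  · exact measurable_excess.comp (@measurable_pi_lambda _ _ _ (𝓕 _) _ _ fun c =>
      hN.measurable_increment c (hle k))
  · refine indep_of_indep_of_le_left (hN.indep_past _ _ (hle k)) ?_
    exact Measurable.comap_le (measurable_excess.comp (comap_measurable _))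
  · rw [hN.integral_excess (hle k), hsub]
  · have := hN.integral_excess_sq_le (hle k)
    simpa only [hsub] using this

end IsPoissonFamily

/-! ### Visit frequencies along a time grid -/

section Grid

/-- The fraction of the first `n` terms of the sequence `x` that are equal to `a` (`0` if
`n = 0`). -/
noncomputable def visitFrequency (x : ℕ → State) (n : ℕ) (a : State) : ℝ :=
  (∑ k ∈ Finset.range n, if x k = a then 1 else 0) / n

variable {x : ℕ → State} {ν : ℕ → Event → ℕ} {r : Event → ℝ≥0} {h e : ℝ}

theorem sum_visitFrequency_mul (x : ℕ → State) (n : ℕ) (g : State → ℝ) :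
    ∑ a, visitFrequency x n a * g a = (∑ k ∈ Finset.range n, g (x k)) / n := by
  simp_rw [visitFrequency, div_mul_eq_mul_div, Finset.sum_mul]
  rw [← Finset.sum_div, Finset.sum_comm]
  simp

theorem sum_visitFrequency (x : ℕ → State) {n : ℕ} (hn : n ≠ 0) :
    ∑ a, visitFrequency x n a = 1 := by
  have h := sum_visitFrequency_mul x n fun _ => 1
  have hn' : (n : ℝ) ≠ 0 := Nat.cast_ne_zero.2 hn
  simpa [hn'] using h

theorem tendsto_sum_mul_sub_div_of_indicator {c : Event}
    (hlln : ∀ a, Tendsto (fun n : ℕ => (∑ k ∈ Finset.range n,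
      (if x k = a then 1 else 0) * ((ν k c : ℝ) - r c * h)) / (n : ℝ)) atTop (𝓝 0))
    (g : State → ℝ) :
    Tendsto (fun n : ℕ => (∑ k ∈ Finset.range n, g (x k) * ((ν k c : ℝ) - r c * h)) / (n : ℝ))
      atTop (𝓝 0) := by
  have h1 := tendsto_finsetSum (Finset.univ : Finset State) fun a _ => (hlln a).const_mul (g a)
  simp only [mul_zero, Finset.sum_const_zero] at h1
  refine h1.congr fun n => ?_
  simp_rw [mul_div_assoc', Finset.mul_sum]
  rw [← Finset.sum_div, Finset.sum_comm]
  simp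

/-- The visit frequencies nearly solve the balance equations: the change of an indicator along the
grid telescopes, so the mean effect of the ticks on it vanishes in the long run, up to the excess. -/
theorem eventually_abs_vecMul_visitFrequency_mul_le
    (hstep : ∀ j k, |(if x (k + 1) = j then (1 : ℝ) else 0) - (if x k = j then 1 else 0)
      - ∑ c, ((if step c (x k) = j then (1 : ℝ) else 0) - (if x k = j then 1 else 0)) * (ν k c : ℝ)|
        ≤ 2 * excess (ν k))
    (hlln : ∀ c a, Tendsto (fun n : ℕ => (∑ k ∈ Finset.range n,
      (if x k = a then 1 else 0) * ((ν k c : ℝ) - r c * h)) / (n : ℝ)) atTop (𝓝 0))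
    (hexc : Tendsto (fun n : ℕ => (∑ k ∈ Finset.range n, excess (ν k)) / (n : ℝ)) atTop (𝓝 e))
    (hh : 0 ≤ h) {b : ℝ} (hb : 2 * e < b) (j : State) :
    ∀ᶠ n in atTop, |Matrix.vecMul (visitFrequency x n) (generator r) j| * h ≤ b := by
  set f : State → ℝ := fun y => if y = j then 1 else 0 with hf
  set D : ℕ → ℝ := fun n => ∑ c, (∑ k ∈ Finset.range n,
    (f (step c (x k)) - f (x k)) * ((ν k c : ℝ) - r c * h)) / (n : ℝ) with hD
  have hDlim : Tendsto D atTop (𝓝 0) := by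
    have h1 := tendsto_finsetSum (Finset.univ : Finset Event) fun c _ =>
      tendsto_sum_mul_sub_div_of_indicator (hlln c) fun y => f (step c y) - f y
    simpa using h1
  have hlim : Tendsto (fun n : ℕ => |D n| + 1 / (n : ℝ)
      + 2 * ((∑ k ∈ Finset.range n, excess (ν k)) / (n : ℝ))) atTop (𝓝 (2 * e)) := by
    have h1 := (hDlim.abs.add (tendsto_const_div_atTop_nhds_zero_nat (1 : ℝ))).add
      (hexc.const_mul 2)
    simpa using h1
  filter_upwards [hlim.eventually_le_const hb, eventually_ge_atTop 1] with n hn hn1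
  refine le_trans ?_ hn
  have hn0 : (0 : ℝ) < n := by exact_mod_cast hn1
  have hvec : Matrix.vecMul (visitFrequency x n) (generator r) j
      = (∑ k ∈ Finset.range n, ∑ c, (f (step c (x k)) - f (x k)) * (r c : ℝ)) / n := by
    rw [← sum_visitFrequency_mul x n fun y => ∑ c, (f (step c y) - f y) * (r c : ℝ)]
    simp only [Matrix.vecMul, dotProduct, generator_apply, hf]
  have herr : |f (x n) - f (x 0) - ∑ k ∈ Finset.range n,
      ∑ c, (f (step c (x k)) - f (x k)) * (ν k c : ℝ)|
        ≤ 2 * ∑ k ∈ Finset.range n, excess (ν k) := by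
    rw [← Finset.sum_range_sub (fun k => f (x k)), ← Finset.sum_sub_distrib, Finset.mul_sum]
    exact (Finset.abs_sum_le_sum_abs _ _).trans (Finset.sum_le_sum fun k _ => hstep j k)
  have hf1 : |f (x n) - f (x 0)| ≤ 1 := by
    simp only [hf]
    split_ifs <;> norm_num
  have hdecomp : (∑ k ∈ Finset.range n, ∑ c, (f (step c (x k)) - f (x k)) * (r c : ℝ)) * h
      = ∑ k ∈ Finset.range n, ∑ c, (f (step c (x k)) - f (x k)) * (ν k c : ℝ) - D n * n := by
    have h1 : D n * n = ∑ k ∈ Finset.range n, ∑ c,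
        (f (step c (x k)) - f (x k)) * ((ν k c : ℝ) - r c * h) := by
      simp only [hD]
      rw [← Finset.sum_div, div_mul_cancel₀ _ hn0.ne', Finset.sum_comm]
    rw [h1, ← Finset.sum_sub_distrib, Finset.sum_mul]
    refine Finset.sum_congr rfl fun k _ => ?_
    rw [← Finset.sum_sub_distrib, Finset.sum_mul]
    exact Finset.sum_congr rfl fun c _ => by ring
  rw [hvec, abs_div, abs_of_pos hn0, div_mul_eq_mul_div, div_le_iff₀ hn0,
    ← abs_of_nonneg hh, ← abs_mul, hdecomp]
  have hR : (|D n| + 1 / (n : ℝ) + 2 * ((∑ k ∈ Finset.range n, excess (ν k)) / (n : ℝ))) * n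
      = |D n * n| + 1 + 2 * ∑ k ∈ Finset.range n, excess (ν k) := by
    rw [abs_mul, abs_of_pos hn0]
    field_simp
  rw [hR]
  have h2 := neg_abs_le (D n * n)
  have h3 := le_abs_self (D n * n)
  rw [abs_le] at herr hf1 ⊢
  constructor <;> linarith [herr.1, herr.2, hf1.1, hf1.2]

/-- The requests that find the state in `A` occur at the rate of the clock times the visit frequency
of `A`, up to the excess. -/
theorem eventually_abs_count_div_sub_le {K : ℕ → ℝ} {c : Event} {A : Finset State}
    (hK0 : K 0 = 0)
    (hK : ∀ k, |K (k + 1) - K k - (if x k ∈ A then 1 else 0) * (ν k c : ℝ)| ≤ excess (ν k))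
    (hlln : ∀ a, Tendsto (fun n : ℕ => (∑ k ∈ Finset.range n,
      (if x k = a then 1 else 0) * ((ν k c : ℝ) - r c * h)) / (n : ℝ)) atTop (𝓝 0))
    (hexc : Tendsto (fun n : ℕ => (∑ k ∈ Finset.range n, excess (ν k)) / (n : ℝ)) atTop (𝓝 e))
    {b : ℝ} (hb : e < b) :
    ∀ᶠ n : ℕ in atTop, |K n / n - r c * h * ∑ a ∈ A, visitFrequency x n a| ≤ b := by
  set g : State → ℝ := fun y => if y ∈ A then 1 else 0 with hg
  set D : ℕ → ℝ := fun n => (∑ k ∈ Finset.range n, g (x k) * ((ν k c : ℝ) - r c * h)) / (n : ℝ)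
    with hD
  have hDlim : Tendsto D atTop (𝓝 0) := tendsto_sum_mul_sub_div_of_indicator hlln g
  have hlim : Tendsto (fun n : ℕ => |D n| + (∑ k ∈ Finset.range n, excess (ν k)) / (n : ℝ))
      atTop (𝓝 e) := by
    simpa using hDlim.abs.add hexc
  filter_upwards [hlim.eventually_le_const hb, eventually_ge_atTop 1] with n hn hn1
  refine le_trans ?_ hn
  have hn0 : (0 : ℝ) < n := by exact_mod_cast hn1
  have herr : |K n - ∑ k ∈ Finset.range n, g (x k) * (ν k c : ℝ)|
      ≤ ∑ k ∈ Finset.range n, excess (ν k) := by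
    have h1 : K n = ∑ k ∈ Finset.range n, (K (k + 1) - K k) := by
      rw [Finset.sum_range_sub, hK0, sub_zero]
    rw [h1, ← Finset.sum_sub_distrib]
    exact (Finset.abs_sum_le_sum_abs _ _).trans (Finset.sum_le_sum fun k _ => hK k)
  have hfreq : ∑ a ∈ A, visitFrequency x n a = (∑ k ∈ Finset.range n, g (x k)) / n := by
    rw [← sum_visitFrequency_mul]
    simp only [hg, mul_ite, mul_one, mul_zero]
    rw [← Finset.sum_filter, Finset.filter_mem_eq_inter, Finset.univ_inter]
  have hsum : ∑ k ∈ Finset.range n, g (x k) * (ν k c : ℝ)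
      = D n * n + r c * h * ∑ k ∈ Finset.range n, g (x k) := by
    rw [hD, div_mul_cancel₀ _ hn0.ne', Finset.mul_sum, ← Finset.sum_add_distrib]
    exact Finset.sum_congr rfl fun k _ => by ring
  have hsplit : K n / n - r c * h * ∑ a ∈ A, visitFrequency x n a
      = D n + (K n - ∑ k ∈ Finset.range n, g (x k) * (ν k c : ℝ)) / n := by
    rw [hfreq, hsum]
    field_simp
    ring
  rw [hsplit]
  refine (abs_add_le _ _).trans (add_le_add le_rfl ?_)
  rw [abs_div, abs_of_pos hn0]
  gcongr

end Grid

/-! ### The long-run request counts -/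

section Limit

variable {α β γ μ lam : ℝ≥0} {n : Event → ℝ≥0 → ℕ} {y : ℝ≥0 → State}

/-- For a counting path, convergence of the time averages along the integers is enough. -/
theorem tendsto_div_of_tendsto_natCast {K : ℝ≥0 → ℕ} (hK : Monotone K) {l : ℝ}
    (h : Tendsto (fun j : ℕ => (K j : ℝ) / j) atTop (𝓝 l)) :
    Tendsto (fun T : ℝ≥0 => (K T : ℝ) / T) atTop (𝓝 l) := by
  have hcoe : Tendsto (fun T : ℝ≥0 => (T : ℝ)) atTop atTop := NNReal.tendsto_coe_atTop.2 tendsto_id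
  have hfloor : Tendsto (fun T : ℝ≥0 => ⌊(T : ℝ)⌋₊) atTop atTop :=
    tendsto_nat_floor_atTop.comp hcoe
  have hratio : Tendsto (fun T : ℝ≥0 => (⌊(T : ℝ)⌋₊ : ℝ) / T) atTop (𝓝 1) :=
    tendsto_nat_floor_div_atTop.comp hcoe
  have hratio' : Tendsto (fun T : ℝ≥0 => ((⌊(T : ℝ)⌋₊ + 1 : ℕ) : ℝ) / T) atTop (𝓝 1) := by
    have h1 := hratio.add (tendsto_inv_atTop_zero.comp hcoe)
    rw [add_zero] at h1
    refine h1.congr fun T => ?_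
    simp only [Function.comp_apply]
    push_cast
    ring
  have hlow : Tendsto (fun T : ℝ≥0 => (K (⌊(T : ℝ)⌋₊ : ℕ) : ℝ) / T) atTop (𝓝 l) := by
    have h1 := (h.comp hfloor).mul hratio
    rw [mul_one] at h1
    refine h1.congr' ?_
    filter_upwards [hfloor.eventually_ge_atTop 1] with T hT
    have : (⌊(T : ℝ)⌋₊ : ℝ) ≠ 0 := by positivity
    simp only [Function.comp_apply]
    field_simp
  have hupp : Tendsto (fun T : ℝ≥0 => (K ((⌊(T : ℝ)⌋₊ + 1 : ℕ) : ℝ≥0) : ℝ) / T) atTop (𝓝 l) := by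
    have h1 := (h.comp ((tendsto_add_atTop_nat 1).comp hfloor)).mul hratio'
    rw [mul_one] at h1
    refine h1.congr fun T => ?_
    have : ((⌊(T : ℝ)⌋₊ + 1 : ℕ) : ℝ) ≠ 0 := by positivity
    simp only [Function.comp_apply]
    field_simp
  refine tendsto_of_tendsto_of_tendsto_of_le_of_le hlow hupp (fun T => ?_) fun T => ?_
  · have h1 : ((⌊(T : ℝ)⌋₊ : ℕ) : ℝ≥0) ≤ T := by
      rw [← NNReal.coe_le_coe]
      exact_mod_cast Nat.floor_le T.2
    have h2 : (K (⌊(T : ℝ)⌋₊ : ℕ) : ℝ) ≤ K T := by exact_mod_cast hK h1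
    dsimp only
    gcongr
  · have h1 : T ≤ ((⌊(T : ℝ)⌋₊ + 1 : ℕ) : ℝ≥0) := by
      rw [← NNReal.coe_le_coe]
      exact_mod_cast (Nat.lt_floor_add_one (T : ℝ)).le
    have h2 : (K T : ℝ) ≤ K ((⌊(T : ℝ)⌋₊ + 1 : ℕ) : ℝ≥0) := by exact_mod_cast hK h1
    dsimp only
    gcongr

/-- On a path whose grid statistics obey the law of large numbers for every mesh `1 / (M + 1)`, the
rate of the requests that find the state in `A` is `lam * π(A)`: for each mesh `h` this holds up to
an error of order `h`, because the excess of ticks per step has mean `O(h ^ 2)`. -/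
theorem IsDrivenBy.tendsto_ncard_requestTimes_div (hα : 0 < α) (hβ : 0 < β) (hγ : 0 < γ)
    (hμ : 0 < μ) (hlam : 0 < lam) {π : State → ℝ}
    (hπ : IsStationary (generator (rate α β γ μ lam)) π) (hy : IsDrivenBy n y)
    (hn : ∀ c, Monotone (n c)) (hrc : ∀ c t, ∀ᶠ s in 𝓝[>] t, n c s = n c t)
    (hlln : ∀ M : ℕ, ∀ h : ℝ≥0, h = 1 / (M + 1) → ∀ c a, Tendsto (fun m : ℕ =>
      (∑ k ∈ Finset.range m, (if y (k * h) = a then 1 else 0) *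
        (((n c ((k + 1 : ℕ) * h) - n c (k * h) : ℕ) : ℝ) - rate α β γ μ lam c * h)) / (m : ℝ))
      atTop (𝓝 0))
    (hexc : ∀ M : ℕ, ∀ h : ℝ≥0, h = 1 / (M + 1) → Tendsto (fun m : ℕ => (∑ k ∈ Finset.range m,
      excess fun c => n c ((k + 1 : ℕ) * h) - n c (k * h)) / (m : ℝ))
      atTop (𝓝 ((∑ c, (rate α β γ μ lam c : ℝ)) * h *
        (1 - Real.exp (-((∑ c, (rate α β γ μ lam c : ℝ)) * h))))))
    (A : Finset State) :
    Tendsto (fun T : ℝ≥0 => ((requestTimes n y A 0 T).ncard : ℝ) / T) atTop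
      (𝓝 (lam * ∑ a ∈ A, π a)) := by
  set r := rate α β γ μ lam with hr
  set R : ℝ := ∑ c, (r c : ℝ) with hR
  have hRpos : 0 < R := by
    refine Finset.sum_pos (fun c _ => ?_) ⟨.request, Finset.mem_univ _⟩
    cases c <;> simpa [hr, rate]
  have hmono : Monotone fun T => (requestTimes n y A 0 T).ncard := fun s t hst => by
    dsimp only
    rw [ncard_requestTimes_add hn A zero_le hst]
    exact Nat.le_add_right _ _
  refine tendsto_div_of_tendsto_natCast hmono ?_
  obtain ⟨C, hC0, hC⟩ := exists_abs_sub_le_of_isStationary hα hβ hγ hμ hlam hπ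
  set B : ℝ := 2 * R ^ 2 + lam * (A.card * (C * (3 * R ^ 2))) with hB
  have hmesh : ∀ M : ℕ, ∀ᶠ j : ℕ in atTop, |((requestTimes n y A 0 j).ncard : ℝ) / j
      - lam * ∑ a ∈ A, π a| ≤ B * (1 / ((M : ℝ) + 1)) := by
    intro M
    obtain ⟨h, hh⟩ : ∃ h : ℝ≥0, h = 1 / (M + 1) := ⟨_, rfl⟩
    have hh' : (h : ℝ) = 1 / ((M : ℝ) + 1) := by rw [hh]; push_cast; rfl
    have hhpos : (0 : ℝ) < h := by rw [hh']; positivity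
    have hle : ∀ k : ℕ, (k : ℝ≥0) * h ≤ (k + 1 : ℕ) * h := fun k => by gcongr; simp
    specialize hlln M h hh
    specialize hexc M h hh
    have he : R * h * (1 - Real.exp (-(R * h))) ≤ (R * h) ^ 2 := by
      have := Real.add_one_le_exp (-(R * h))
      have : 0 < R * h := by positivity
      nlinarith
    have hRh : 0 < (R * h) ^ 2 := by positivity
    -- any factor above `2` makes the bound strict, since the excess has mean at most `(R * h) ^ 2`
    have hbalance : ∀ j, ∀ᶠ m in atTop,
        |Matrix.vecMul (visitFrequency (fun k : ℕ => y (k * h)) m) (generator r) j| * h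
          ≤ 3 * (R * h) ^ 2 := fun j => by
      refine eventually_abs_vecMul_visitFrequency_mul_le
        (ν := fun (k : ℕ) c => n c ((k + 1 : ℕ) * h) - n c (k * h)) (fun j k => ?_) hlln hexc
        hhpos.le (by linarith) j
      refine hy.abs_sub_sub_sum_le hn hrc (hle k) (f := fun z => if z = j then 1 else 0)
        (fun z => ?_) fun z => ?_
      · split_ifs <;> norm_num
      · split_ifs <;> norm_num
    have hcount := eventually_abs_count_div_sub_le
      (K := fun k : ℕ => ((requestTimes n y A 0 (k * h)).ncard : ℝ)) (c := .request) (A := A)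
      (x := fun k : ℕ => y (k * h)) (ν := fun (k : ℕ) c => n c ((k + 1 : ℕ) * h) - n c (k * h))
      (b := 2 * (R * h) ^ 2) ?_ (fun k => ?_) (hlln .request) hexc (by linarith)
    · -- the integer time `j` is the grid point number `(M + 1) * j`
      have hmul : Tendsto (fun j : ℕ => (M + 1) * j) atTop atTop :=
        tendsto_id.const_mul_atTop' (Nat.succ_pos M)
      filter_upwards [hmul.eventually hcount, hmul.eventually (eventually_all.2 hbalance),
        eventually_ge_atTop 1] with j hj1 hj2 hj
      set m := (M + 1) * j with hm
      have hm0 : m ≠ 0 := by positivity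
      have hmh : (m : ℝ≥0) * h = j := by
        rw [hm, hh]
        push_cast
        field_simp
      have hmh' : (m : ℝ) * h = j := by exact_mod_cast congr_arg NNReal.toReal hmh
      set p := visitFrequency (fun k : ℕ => y (k * h)) m with hp
      have hpπ : ∀ a, |p a - π a| ≤ C * (3 * R ^ 2 * h) := by
        refine hC p _ (by positivity) (sum_visitFrequency _ hm0) fun i => ?_
        have h1 := hj2 i
        refine le_of_mul_le_mul_right (h1.trans (le_of_eq ?_)) hhpos
        ring
      have hsum : |∑ a ∈ A, p a - ∑ a ∈ A, π a| ≤ A.card * (C * (3 * R ^ 2 * h)) := by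
        rw [← Finset.sum_sub_distrib, ← nsmul_eq_mul]
        exact (Finset.abs_sum_le_sum_abs _ _).trans (Finset.sum_le_card_nsmul _ _ _ fun a _ => hpπ a)
      rw [hmh] at hj1
      have hfirst : |((requestTimes n y A 0 j).ncard : ℝ) / j - lam * ∑ a ∈ A, p a|
          ≤ 2 * R ^ 2 * h := by
        refine le_of_mul_le_mul_right ?_ hhpos
        rw [← abs_of_pos hhpos, ← abs_mul, abs_of_pos hhpos]
        have hm0' : (m : ℝ) ≠ 0 := Nat.cast_ne_zero.2 hm0
        have h1 : (((requestTimes n y A 0 j).ncard : ℝ) / j - lam * ∑ a ∈ A, p a) * h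
            = ((requestTimes n y A 0 j).ncard : ℝ) / m - lam * h * ∑ a ∈ A, p a := by
          rw [← hmh']
          field_simp
        rw [h1]
        exact hj1.trans (le_of_eq (by ring))
      calc |((requestTimes n y A 0 j).ncard : ℝ) / j - lam * ∑ a ∈ A, π a|
          = |(((requestTimes n y A 0 j).ncard : ℝ) / j - lam * ∑ a ∈ A, p a)
              + lam * (∑ a ∈ A, p a - ∑ a ∈ A, π a)| := by
            congr 1
            ring
        _ ≤ 2 * R ^ 2 * h + lam * (A.card * (C * (3 * R ^ 2 * h))) := by
            refine (abs_add_le _ _).trans (add_le_add hfirst ?_)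
            rw [abs_mul, abs_of_nonneg (NNReal.coe_nonneg lam)]
            exact mul_le_mul_of_nonneg_left hsum lam.2
        _ = B * (1 / ((M : ℝ) + 1)) := by
            rw [← hh', hB]
            ring
    · have h1 : requestTimes n y A 0 0 = ∅ :=
        Set.eq_empty_of_forall_notMem fun u hu => absurd hu.1 (not_lt.2 hu.2.1)
      simp [h1]
    · have h1 := hy.abs_ncard_requestTimes_sub_le hn hrc (hle k) A
      rw [ncard_requestTimes_add hn A zero_le (hle k), Nat.cast_add, add_sub_cancel_left]
      exact h1
  have hB0 : Tendsto (fun M : ℕ => B * (1 / ((M : ℝ) + 1))) atTop (𝓝 0) := by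
    simpa using (tendsto_one_div_add_atTop_nhds_zero_nat (𝕜 := ℝ)).const_mul B
  rw [Metric.tendsto_nhds]
  intro ε hε
  obtain ⟨M, hM⟩ := (hB0.eventually_lt_const hε).exists
  filter_upwards [hmesh M] with j hj
  rw [Real.dist_eq]
  exact hj.trans_lt hM

variable {Ω : Type*} {mΩ : MeasurableSpace Ω} {P : Measure Ω} [IsProbabilityMeasure P]
  {𝓕 : Filtration ℝ≥0 mΩ} {N : Event → ℝ≥0 → Ω → ℕ} {Y : ℝ≥0 → Ω → State}

theorem requestCount_eq_ncard_requestTimes (N : Event → ℝ≥0 → Ω → ℕ) (Y : ℝ≥0 → Ω → State)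
    (A : Finset State) (T : ℝ≥0) (ω : Ω) :
    requestCount N Y A T ω
      = (requestTimes (fun c t => N c t ω) (fun t => Y t ω) A 0 T).ncard := by
  unfold requestCount requestTimes
  congr 1
  ext t
  exact ⟨fun h => ⟨h.2.1.1, h⟩, fun h => h.2⟩

theorem IsMarkovMachine.ae_tendsto_requestCount_div (hα : 0 < α) (hβ : 0 < β) (hγ : 0 < γ)
    (hμ : 0 < μ) (hlam : 0 < lam) {π : State → ℝ}
    (hπ : IsStationary (generator (rate α β γ μ lam)) π)
    (hY : IsMarkovMachine P 𝓕 (rate α β γ μ lam) N Y) :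
    ∀ᵐ ω ∂P, ∀ A, Tendsto (fun T : ℝ≥0 => (requestCount N Y A T ω : ℝ) / T) atTop
      (𝓝 (lam * ∑ a ∈ A, π a)) := by
  have hlln : ∀ᵐ ω ∂P, ∀ M : ℕ, ∀ h : ℝ≥0, h = 1 / (M + 1) → ∀ c a, Tendsto (fun m : ℕ =>
      (∑ k ∈ Finset.range m, (if Y (k * h) ω = a then 1 else 0) *
        (((N c ((k + 1 : ℕ) * h) ω - N c (k * h) ω : ℕ) : ℝ) - rate α β γ μ lam c * h)) / (m : ℝ))
      atTop (𝓝 0) := by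
    simp only [forall_eq, ae_all_iff]
    intro M c a
    refine hY.clocks.ae_tendsto_thinned_increment _ c
      (A := fun k ω => if Y (k * (1 / (M + 1))) ω = a then 1 else 0) (fun k => ?_)
      (fun k ω => ?_) fun k ω => ?_
    · exact Measurable.ite (hY.adapted _ (measurableSet_singleton a)) measurable_const
        measurable_const
    · split_ifs <;> norm_num
    · split_ifs <;> norm_num
  have hexc : ∀ᵐ ω ∂P, ∀ M : ℕ, ∀ h : ℝ≥0, h = 1 / (M + 1) → Tendsto (fun m : ℕ =>
      (∑ k ∈ Finset.range m, excess fun c => N c ((k + 1 : ℕ) * h) ω - N c (k * h) ω) / (m : ℝ))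
      atTop (𝓝 ((∑ c, (rate α β γ μ lam c : ℝ)) * h *
        (1 - Real.exp (-((∑ c, (rate α β γ μ lam c : ℝ)) * h))))) := by
    simp only [forall_eq]
    rw [ae_all_iff]
    exact fun M => hY.clocks.ae_tendsto_excess _
  filter_upwards [hlln, hexc, hY.clocks.mono, hY.clocks.right_cont, hY.driven]
    with ω h1 h2 h3 h4 h5 A
  simp_rw [requestCount_eq_ncard_requestTimes]
  exact h5.tendsto_ncard_requestTimes_div hα hβ hγ hμ hlam hπ h3 h4 h1 h2 A

/-- Almost surely the ratio converges to a constant, so its upper limit has that constant as its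
expectation. -/
theorem IsMarkovMachine.integral_limsup_ratio (hα : 0 < α) (hβ : 0 < β) (hγ : 0 < γ)
    (hμ : 0 < μ) (hlam : 0 < lam) {π : State → ℝ}
    (hπ : IsStationary (generator (rate α β γ μ lam)) π)
    (hY : IsMarkovMachine P 𝓕 (rate α β γ μ lam) N Y) (A : Finset State) {B : Finset State}
    (hB : 0 < ∑ i ∈ B, π i) :
    ∫ ω, limsup (fun T : ℝ≥0 =>
      (requestCount N Y A T ω : ℝ) / (requestCount N Y B T ω : ℝ)) atTop ∂P
      = (∑ i ∈ A, π i) / ∑ i ∈ B, π i := by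
  have hlam' : (lam : ℝ) ≠ 0 := by exact_mod_cast hlam.ne'
  have hae : ∀ᵐ ω ∂P, limsup (fun T : ℝ≥0 =>
      (requestCount N Y A T ω : ℝ) / (requestCount N Y B T ω : ℝ)) atTop
      = (∑ i ∈ A, π i) / ∑ i ∈ B, π i := by
    filter_upwards [hY.ae_tendsto_requestCount_div hα hβ hγ hμ hlam hπ] with ω hω
    have h1 := (hω A).div (hω B) (mul_ne_zero hlam' hB.ne')
    rw [mul_div_mul_left _ _ hlam'] at h1
    refine Tendsto.limsup_eq (h1.congr' ?_)
    filter_upwards [eventually_gt_atTop 0] with T hT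
    exact div_div_div_cancel_right₀ (by exact_mod_cast hT.ne') _ _
  rw [integral_congr_ae hae]
  simp

end Limit

end MarkovMachine

theorem corollary1 {Ω : Type*} {mΩ : MeasurableSpace Ω} (P : Measure Ω) [IsProbabilityMeasure P]
    (𝓕 : Filtration ℝ≥0 mΩ) (α β γ μ lam : ℝ≥0)
    (hα : 0 < α) (hβ : 0 < β) (hγ : 0 < γ) (hμ : 0 < μ) (hlam : 0 < lam)
    (N : MarkovMachine.Event → ℝ≥0 → Ω → ℕ) (Y : ℝ≥0 → Ω → MarkovMachine.State)
    (hY : MarkovMachine.IsMarkovMachine P 𝓕 (MarkovMachine.rate α β γ μ lam) N Y) :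
    (∃! π : MarkovMachine.State → ℝ, MarkovMachine.IsStationary
      (MarkovMachine.generator (MarkovMachine.rate α β γ μ lam)) π) ∧
    ∀ π : MarkovMachine.State → ℝ, MarkovMachine.IsStationary
        (MarkovMachine.generator (MarkovMachine.rate α β γ μ lam)) π →
      0 < ∑ i ∈ MarkovMachine.acceptStates, π i ∧
      0 < ∑ i ∈ MarkovMachine.rejectStates, π i ∧
      MarkovMachine.FAR P N Y =
        (∑ i ∈ MarkovMachine.falseAcceptStates, π i) / ∑ i ∈ MarkovMachine.acceptStates, π i ∧
      MarkovMachine.FRR P N Y =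
        (∑ i ∈ MarkovMachine.falseRejectStates, π i) / ∑ i ∈ MarkovMachine.rejectStates, π i := by
  refine ⟨MarkovMachine.existsUnique_isStationary hα hβ hγ hμ hlam, fun π hπ => ?_⟩
  have hpos := hπ.pos hα hβ hγ hμ hlam
  have hA : 0 < ∑ i ∈ MarkovMachine.acceptStates, π i :=
    Finset.sum_pos (fun i _ => hpos i) ⟨⟨(0, 0), by decide⟩, by decide⟩
  have hR : 0 < ∑ i ∈ MarkovMachine.rejectStates, π i :=
    Finset.sum_pos (fun i _ => hpos i) ⟨⟨(2, 2), by decide⟩, by decide⟩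
  exact ⟨hA, hR, hY.integral_limsup_ratio hα hβ hγ hμ hlam hπ _ hA,
    hY.integral_limsup_ratio hα hβ hγ hμ hlam hπ _ hR⟩
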